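/- **Gaussian domination.** Let $\nu,L\ge 1$ be integers and let $\Lambda=\{-L+1,\dots,L\}^\nu\subset\mathbb Z^\nu$, with $x+e_\mu$ ($x\in\Lambda$, $\mu=1,\dots,\nu$) understood periodically, i.e. the coordinate $L+1$ is identified with $-L+1$. Let $\psi_i(x)$, $i=1,2,3$, $x\in\Lambda$, be the fermion operators on the fermionic Fock space of dimension $2^{3|\Lambda|}$, so that $\{\psi_i(x),\psi_j^\dagger(y)\}=\delta_{x,y}\delta_{i,j}$ and $\{\psi_i(x),\psi_j(y)\}=0$. Put $\Psi(x)=(\psi_1(x),\psi_2(x),\psi_3(x))^{T}$, $\Psi^\dagger(x)=(\psi_1^\dagger(x),\psi_2^\dagger(x),\psi_3^\dagger(x))$ and $S^{(a)}(x)=\Psi^\dagger(x)\lambda^{(a)}\Psi(x)$, where $\lambda^{(1)},\dots,\lambda^{(8)}$ are the Gell-Mann matrices. Write $(-1)^x=(-1)^{x^{(1)}+\cdots+x^{(\nu)}}$ and $\theta_\mu(x)=x^{(1)}+\cdots+x^{(\mu-1)}+\mathbf 1[x^{(\mu)}=L]$. For $\kappa\in\mathbb R$ and $m,g\ge0$ let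 $$H_K^{(\Lambda)}=i\kappa\sum_{x\in\Lambda}\sum_{\mu=1}^\nu(-1)^{\theta_\mu(x)}\left[\Psi^\dagger(x)\Psi(x+e_\mu)-\Psi^\dagger(x+e_\mu)\Psi(x)\right],\qquad O^{(\Lambda)}=\sum_{x\in\Lambda}(-1)^x S^{(2)}(x),$$ $$H^{(\Lambda)}(m)=H_K^{(\Lambda)}+m\,O^{(\Lambda)}+g\sum_{x\in\Lambda}\sum_{\mu=1}^\nu\sum_{a=1}^8S^{(a)}(x)S^{(a)}(x+e_\mu).$$ For real-valued $h=(h^{(1)},\dots,h^{(\nu)})$, $h^{(\mu)}:\Lambda\to\mathbb R$, let $H^{(\Lambda)}(m,h)=H_K^{(\Lambda)}+H_{\rm int}^{(\Lambda)}(h)+m\,O^{(\Lambda)}$ with $$\begin{aligned}H_{\rm int}^{(\Lambda)}(h)={}&\frac g2\sum_{x\in\Lambda}\sum_{\mu=1}^\nu\left[S^{(3)}(x)+S^{(3)}(x+e_\mu)+(-1)^xh^{(\mu)}(x)\right]^2+\frac g2\sum_{x\in\Lambda}\sum_{\mu=1}^\nu\sum_{b=1,4,6,8}\left[S^{(b)}(x)+S^{(b)}(x+e_\mu)\right]^2\\&-\frac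 g2\sum_{x\in\Lambda}\sum_{\mu=1}^\nu\sum_{b=2,5,7}\left[S^{(b)}(x)-S^{(b)}(x+e_\mu)\right]^2-g\nu\sum_{a=1,3,4,6,8}\sum_{x\in\Lambda}S^{(a)}(x)^2+g\nu\sum_{b=2,5,7}\sum_{x\in\Lambda}S^{(b)}(x)^2.\end{aligned}$$ Then $H^{(\Lambda)}(m,0)=H^{(\Lambda)}(m)$, and for every $\beta\ge0$ and every real-valued $h=(h^{(1)},\dots,h^{(\nu)})$, $$\mathrm{Tr}\,\exp\left[-\beta H^{(\Lambda)}(m,h)\right]\le\mathrm{Tr}\,\exp\left[-\beta H^{(\Lambda)}(m)\right].$$ -/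

import Mathlib

open scoped Matrix ComplexOrder

noncomputable section

namespace NJL

/-! ### Fermion operators on Fock space -/

section Fock

variable {M : Type*} [LinearOrder M]

/-- The sign `(-1)^{#{l ∈ T : l < k}}` picked up when the mode `k` is moved to the front of the
occupied modes `T`. -/
def fermiSign (k : M) (T : Finset M) : ℂ := (-1) ^ (T.filter (· < k)).card

/-- The annihilation operator of the mode `k` on the fermionic Fock space over a finite set `M`
of modes, as a matrix in the orthonormal occupation number basis `|T⟩`, `T ⊆ M`:
`a_k |T⟩ = (-1)^{#{l ∈ T : l < k}} |T \ {k}⟩` if `k ∈ T`, and `a_k |T⟩ = 0` otherwise.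
The creation operator is its adjoint, i.e. its conjugate transpose. -/
def annihilate (k : M) : Matrix (Finset M) (Finset M) ℂ :=
  Matrix.of fun S T => if k ∈ T ∧ S = T.erase k then fermiSign k T else 0

lemma fermiSign_insert {k l : M} {T : Finset M} (h : l ∉ T) :
    fermiSign k (insert l T) = (if l < k then -1 else 1) * fermiSign k T := by
  unfold fermiSign
  rw [Finset.filter_insert]
  split_ifs with hlk
  · rw [Finset.card_insert_of_notMem (by simp [h]), pow_succ]; ring
  · simp

lemma fermiSign_mul_self (k : M) (T : Finset M) : fermiSign k T * fermiSign k T = 1 := by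
  unfold fermiSign
  rw [← mul_pow]; simp

lemma star_fermiSign (k : M) (T : Finset M) : star (fermiSign k T) = fermiSign k T := by
  simp [fermiSign]

variable [Fintype M]

/-- The canonical anticommutation relation `{a_k, a_l} = 0`. -/
lemma annihilate_anticomm (k l : M) :
    annihilate k * annihilate l + annihilate l * annihilate k = 0 := by
  have key : ∀ (k l : M) (S T : Finset M), (annihilate k * annihilate l) S T =
      if l ∈ T ∧ k ∈ T.erase l ∧ S = (T.erase l).erase k then
        fermiSign k (T.erase l) * fermiSign l T else 0 := by
    intro k l S T
    rw [Matrix.mul_apply, Finset.sum_eq_single (T.erase l)]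
    · simp only [annihilate, Matrix.of_apply]
      split_ifs <;> simp_all
    · intro U _ hU
      simp [annihilate, hU]
    · simp
  ext S T
  rw [Matrix.add_apply, key, key, Matrix.zero_apply]
  rcases eq_or_ne k l with rfl | hkl
  · simp
  by_cases hl : l ∈ T
  swap
  · simp [hl]
  by_cases hk : k ∈ T
  swap
  · simp [hk]
  obtain ⟨R, hlR, rfl⟩ : ∃ R, l ∉ R ∧ insert l R = T :=
    ⟨T.erase l, by simp, Finset.insert_erase hl⟩
  obtain ⟨R', hkR, rfl⟩ : ∃ R', k ∉ R' ∧ insert k R' = R :=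
    ⟨R.erase k, by simp, Finset.insert_erase (by simpa [hkl] using hk)⟩
  have hlR' : l ∉ R' := fun h => hlR (Finset.mem_insert_of_mem h)
  have e1 : (insert l (insert k R')).erase l = insert k R' := Finset.erase_insert hlR
  have e2 : (insert l (insert k R')).erase k = insert l R' := by
    rw [Finset.insert_comm]; exact Finset.erase_insert (by simp [hkl, hkR])
  rw [e1, e2, Finset.erase_insert hkR, Finset.erase_insert hlR']
  by_cases hS : S = R'
  swap
  · simp [hS]
  simp only [hS, Finset.mem_insert_self, hl, hk, and_self, if_true]
  rw [fermiSign_insert hkR, fermiSign_insert hlR, fermiSign_insert hkR,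
    Finset.insert_comm, fermiSign_insert (k := k) (l := k) (by simp [hkl, hkR]),
    fermiSign_insert hlR', fermiSign_insert hlR']
  rcases lt_or_gt_of_ne hkl with h | h
  · simp [h, h.not_gt]; ring
  · simp [h, h.not_gt]; ring

/-- The canonical anticommutation relation `{a_k, a_l†} = δ_{k,l}`. -/
lemma annihilate_anticomm_conjTranspose (k l : M) :
    annihilate k * (annihilate l)ᴴ + (annihilate l)ᴴ * annihilate k = if k = l then 1 else 0 := by
  have key1 : ∀ S T : Finset M, (annihilate k * (annihilate l)ᴴ) S T =
      if l ∉ T ∧ k ∈ insert l T ∧ S = (insert l T).erase k then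
        fermiSign k (insert l T) * fermiSign l (insert l T) else 0 := by
    intro S T
    rw [Matrix.mul_apply, Finset.sum_eq_single (insert l T)]
    · simp only [annihilate, Matrix.of_apply, Matrix.conjTranspose_apply]
      by_cases hl : l ∈ T
      · have : ¬ (T = T.erase l) := fun h => by
          rw [h] at hl; simp at hl
        simp [hl, this]
      · rw [Finset.erase_insert hl]
        split_ifs <;> simp_all [star_fermiSign]
    · intro U _ hU
      have : ¬ (l ∈ U ∧ T = U.erase l) := by
        rintro ⟨h1, rfl⟩; exact hU (Finset.insert_erase h1).symm
      simp [annihilate, this]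
    · simp
  have key2 : ∀ S T : Finset M, ((annihilate l)ᴴ * annihilate k) S T =
      if k ∈ T ∧ l ∉ T.erase k ∧ S = insert l (T.erase k) then
        fermiSign l (insert l (T.erase k)) * fermiSign k T else 0 := by
    intro S T
    rw [Matrix.mul_apply, Finset.sum_eq_single (T.erase k)]
    · simp only [annihilate, Matrix.of_apply, Matrix.conjTranspose_apply, and_true]
      by_cases hk : k ∈ T
      swap
      · simp [hk]
      have : (l ∈ S ∧ T.erase k = S.erase l) ↔ (l ∉ T.erase k ∧ S = insert l (T.erase k)) := by
        constructor
        · rintro ⟨h1, h2⟩; rw [h2]; exact ⟨by simp, (Finset.insert_erase h1).symm⟩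
        · rintro ⟨h1, rfl⟩; exact ⟨by simp, (Finset.erase_insert h1).symm⟩
      by_cases hc : l ∉ T.erase k ∧ S = insert l (T.erase k)
      · rw [if_pos (this.2 hc), if_pos hk, if_pos ⟨hk, hc⟩, star_fermiSign, hc.2]
      · rw [if_neg (fun h => hc (this.1 h)), star_zero, zero_mul,
          if_neg (fun h : k ∈ T ∧ l ∉ T.erase k ∧ S = insert l (T.erase k) => hc h.2)]
    · intro U _ hU
      simp [annihilate, hU]
    · simp
  ext S T
  rw [Matrix.add_apply, key1, key2]
  rcases eq_or_ne k l with rfl | hkl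
  · by_cases hk : k ∈ T
    · simp [hk, Finset.insert_erase hk, fermiSign_mul_self, Matrix.one_apply]
    · simp [hk, Finset.erase_insert hk, fermiSign_mul_self, Matrix.one_apply]
  rw [if_neg hkl, Matrix.zero_apply]
  by_cases hk : k ∈ T
  swap
  · simp [hk, hkl]
  by_cases hl : l ∈ T
  · simp [hl, hkl.symm]
  obtain ⟨R, hkR, rfl⟩ : ∃ R, k ∉ R ∧ insert k R = T :=
    ⟨T.erase k, by simp, Finset.insert_erase hk⟩
  have hlR : l ∉ R := fun h => hl (Finset.mem_insert_of_mem h)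
  have e1 : (insert l (insert k R)).erase k = insert l R := by
    rw [Finset.insert_comm]; exact Finset.erase_insert (by simp [hkl, hkR])
  rw [e1, Finset.erase_insert hkR]
  by_cases hS : S = insert l R
  swap
  · simp [hS]
  simp only [hS, hl, hlR, hk, Finset.mem_insert_of_mem, not_false_eq_true, and_self, if_true]
  rw [fermiSign_insert hl, fermiSign_insert hl, fermiSign_insert hkR, fermiSign_insert hkR,
    fermiSign_insert hlR]
  rcases lt_or_gt_of_ne hkl with h | h
  · simp [h, h.not_gt]; ring
  · simp [h, h.not_gt]; ring

end Fock

/-! ### The lattice -/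

/-- The range `{-L+1, …, L}` of one lattice coordinate. -/
abbrev Coord (L : ℕ) : Type := Set.Icc (-(L : ℤ) + 1) (L : ℤ)

/-- The hypercubic lattice `Λ = {-L+1, …, L}^ν`. -/
abbrev Site (ν L : ℕ) : Type := Fin ν → Coord L

/-- The successor of a coordinate, with the periodic identification of `L + 1` and `-L + 1`. -/
def Coord.next {L : ℕ} (c : Coord L) : Coord L :=
  if h : (c : ℤ) = L then ⟨-(L : ℤ) + 1, le_refl _, c.2.1.trans c.2.2⟩
  else ⟨(c : ℤ) + 1, by have := c.2.1; omega, by have := c.2.2; omega⟩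

/-- The nearest neighbour `x + e_μ` of the site `x`, with periodic identification. -/
def shift {ν L : ℕ} (x : Site ν L) (μ : Fin ν) : Site ν L :=
  Function.update x μ (Coord.next (x μ))

/-- The staggering sign `(-1)^{x^{(1)} + ⋯ + x^{(ν)}}`. -/
def stagger {ν L : ℕ} (x : Site ν L) : ℂ := (-1) ^ (∑ j : Fin ν, ((x j : Coord L) : ℤ))

/-- The exponent `θ_μ(x) = x^{(1)} + ⋯ + x^{(μ-1)}`, increased by one if `x^{(μ)} = L`. -/
def theta {ν L : ℕ} (μ : Fin ν) (x : Site ν L) : ℤ :=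
  (∑ j ∈ Finset.univ.filter (· < μ), ((x j : Coord L) : ℤ)) + if (x μ : ℤ) = L then 1 else 0

/-- The fermion modes: a lattice site together with one of three flavours. The lexicographic
order on the modes only serves to fix the signs in the occupation number basis. -/
def Mode (ν L : ℕ) : Type := Lex (Lex (Site ν L) × Fin 3)

instance (ν L : ℕ) : LinearOrder (Mode ν L) :=
  inferInstanceAs (LinearOrder (Lex (Lex (Site ν L) × Fin 3)))

instance (ν L : ℕ) : Fintype (Mode ν L) :=
  inferInstanceAs (Fintype (Lex (Lex (Site ν L) × Fin 3)))

/-- The mode with flavour `i` at the site `x`. -/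
def mode {ν L : ℕ} (i : Fin 3) (x : Site ν L) : Mode ν L := toLex (toLex x, i)

/-- Operators on the Fock space of the lattice. -/
abbrev Op (ν L : ℕ) : Type := Matrix (Finset (Mode ν L)) (Finset (Mode ν L)) ℂ

/-- The fermion operator `ψ_i(x)`. -/
def psi {ν L : ℕ} (i : Fin 3) (x : Site ν L) : Op ν L := annihilate (mode i x)

/-! ### The Hamiltonians -/

/-- The Gell-Mann matrices `λ^{(a)}`, `a = 1, …, 8` (and `0` for other values of `a`). -/
def gellMann : ℕ → Matrix (Fin 3) (Fin 3) ℂ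
  | 1 => !![0, 1, 0; 1, 0, 0; 0, 0, 0]
  | 2 => !![0, -Complex.I, 0; Complex.I, 0, 0; 0, 0, 0]
  | 3 => !![1, 0, 0; 0, -1, 0; 0, 0, 0]
  | 4 => !![0, 0, 1; 0, 0, 0; 1, 0, 0]
  | 5 => !![0, 0, -Complex.I; 0, 0, 0; Complex.I, 0, 0]
  | 6 => !![0, 0, 0; 0, 0, 1; 0, 1, 0]
  | 7 => !![0, 0, 0; 0, 0, -Complex.I; 0, Complex.I, 0]
  | 8 => ((1 / Real.sqrt 3 : ℝ) : ℂ) • !![1, 0, 0; 0, 1, 0; 0, 0, -2]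
  | _ => 0

variable {ν L : ℕ}

/-- `S^{(a)}(x) = Ψ†(x) λ^{(a)} Ψ(x)`. -/
def spin (a : ℕ) (x : Site ν L) : Op ν L :=
  ∑ i : Fin 3, ∑ j : Fin 3, gellMann a i j • ((psi i x)ᴴ * psi j x)

/-- `Ψ†(x) Ψ(y)`. -/
def hop (x y : Site ν L) : Op ν L := ∑ i : Fin 3, (psi i x)ᴴ * psi i y

/-- The hopping term
`H_K = iκ ∑_x ∑_μ (-1)^{θ_μ(x)} [Ψ†(x) Ψ(x + e_μ) - Ψ†(x + e_μ) Ψ(x)]`. -/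
def kinetic (κ : ℝ) : Op ν L :=
  (Complex.I * (κ : ℂ)) • ∑ x : Site ν L, ∑ μ : Fin ν,
    ((-1 : ℂ) ^ theta μ x) • (hop x (shift x μ) - hop (shift x μ) x)

/-- The order parameter `O = ∑_x (-1)^{x^{(1)} + ⋯ + x^{(ν)}} S^{(2)}(x)`. -/
def orderParameter : Op ν L := ∑ x : Site ν L, stagger x • spin 2 x

/-- The Hamiltonian `H(m)` of the SU(3) Nambu-Jona-Lasinio model. -/
def hamiltonian (κ g m : ℝ) : Op ν L :=
  kinetic κ + (m : ℂ) • orderParameter +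
    (g : ℂ) • ∑ x : Site ν L, ∑ μ : Fin ν, ∑ a ∈ Finset.Icc 1 8, spin a x * spin a (shift x μ)

/-- The interaction `H_int(h)`, in which the `S^{(3)}` bond terms are shifted by the staggered
field `h`. -/
def interaction (g : ℝ) (h : Fin ν → Site ν L → ℝ) : Op ν L :=
  ((g / 2 : ℝ) : ℂ) • (∑ x : Site ν L, ∑ μ : Fin ν,
      (spin 3 x + spin 3 (shift x μ) + (stagger x * (h μ x : ℂ)) • (1 : Op ν L)) ^ 2)
  + ((g / 2 : ℝ) : ℂ) • (∑ x : Site ν L, ∑ μ : Fin ν, ∑ b ∈ ({1, 4, 6, 8} : Finset ℕ),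
      (spin b x + spin b (shift x μ)) ^ 2)
  - ((g / 2 : ℝ) : ℂ) • (∑ x : Site ν L, ∑ μ : Fin ν, ∑ b ∈ ({2, 5, 7} : Finset ℕ),
      (spin b x - spin b (shift x μ)) ^ 2)
  - ((g * ν : ℝ) : ℂ) • (∑ a ∈ ({1, 3, 4, 6, 8} : Finset ℕ), ∑ x : Site ν L, spin a x ^ 2)
  + ((g * ν : ℝ) : ℂ) • (∑ b ∈ ({2, 5, 7} : Finset ℕ), ∑ x : Site ν L, spin b x ^ 2)

/-- The Hamiltonian with field, `H(m, h) = H_K + H_int(h) + m O`. -/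
def hamiltonianField (κ g m : ℝ) (h : Fin ν → Site ν L → ℝ) : Op ν L :=
  kinetic κ + interaction g h + (m : ℂ) • orderParameter

end NJL

end

/-! The proof is reflection positivity followed by a finite maximization. With the field `w(b) =
(-1)^x h` on the bond `b = (x, μ)`, the on-site squares cancel and the Hamiltonian is a sum of bond
contributions plus the order parameter (`interaction_eq`, `hamiltonianField_eq`); `h = 0` gives the
first claim.

Fix a hyperplane bisecting bonds. Let `θ` be the geometric reflection combined with complex
conjugation in the occupation basis, a particle-hole transformation and a gauge sign. It is
multiplicative and antilinear, and sends every `S^(a)(x)` to `-S^(a)(θx)` (`reflOp_spinL`). So the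
repulsive coupling across the plane is `-g S θ(S)`, the staggered order parameter is invariant, and
a field `w` becomes `-w`. The signs `(-1)^{θ_μ}`, including the boundary sign, let the gauge be
chosen so that crossing hopping terms are also `-|κ|` times terms `C θ(C)`. Klein factors make the
two half-lattice algebras commute. Thus `H = A + θ(B) - ∑ C θ(D)` (`bondHamiltonian_glue`). Since
`tr(P θ(Q))` is a nonnegative multiple of `tr P` times the conjugate of `tr Q`, a product formula
for the exponential and Cauchy-Schwarz give `Z(A,B)² ≤ Z(A,A) Z(B,B)` (`norm_exp_sq_le`,
`norm_trace_exp_glue_sq_le`). A crossing bond carries the field `p - q`, which vanishes in both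
symmetrized fields.

Finally, among fields with values in the finite set of `0` and `±w(b)`, take a maximizer of `Z` with
the fewest nonzero bonds. If it is nonzero at some bond, reflect in a plane crossing that bond: both
symmetrized fields are maximizers, and one has fewer nonzero bonds (`partitionFn_le_zero`). -/

open scoped Matrix ComplexOrder

noncomputable section

namespace NJL

/-! ### Representations of the canonical anticommutation relations -/

section CAR

variable {M : Type*} [LinearOrder M] {B : Type*} [Ring B]

/-- The families `b` and `b'` satisfy the canonical anticommutation relations, `b` in the role of
the annihilation operators and `b'` in that of the creation operators. -/
structure IsCAR (b b' : M → B) : Prop where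
  anti : ∀ k l, b k * b l + b l * b k = 0
  anti' : ∀ k l, b' k * b' l + b' l * b' k = 0
  mixed : ∀ k l, b k * b' l + b' l * b k = if k = l then 1 else 0

/-- The product of the values of `f` on `T`, in increasing order. -/
def orderedProd (f : M → B) (T : Finset M) : B := (T.sort.map f).prod

@[simp] lemma orderedProd_empty (f : M → B) : orderedProd f ∅ = 1 := by simp [orderedProd]

lemma orderedProd_insert (f : M → B) {m : M} {T : Finset M} (h : ∀ x ∈ T, m < x) :
    orderedProd f (insert m T) = f m * orderedProd f T := by
  unfold orderedProd
  rw [Finset.sort_insert _ (fun b hb => (h b hb).le) (fun hm => lt_irrefl _ (h m hm))]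
  simp

lemma commute_orderedProd {x : B} {f : M → B} {T : Finset M} (hx : ∀ k ∈ T, Commute x (f k)) :
    Commute x (orderedProd f T) := by
  apply Commute.list_prod_right
  intro y hy
  obtain ⟨k, hk, rfl⟩ := List.mem_map.1 hy
  exact hx k ((Finset.mem_sort _).1 hk)

/-- The product of the annihilation operators in `T`, in decreasing order. -/
def revProd (f : M → B) (T : Finset M) : B :=
  (orderedProd (fun k => MulOpposite.op (f k)) T).unop

@[simp] lemma revProd_empty (f : M → B) : revProd f ∅ = 1 := by simp [revProd]

lemma revProd_insert (f : M → B) {m : M} {T : Finset M} (hm : ∀ x ∈ T, m < x) :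
    revProd f (insert m T) = revProd f T * f m := by
  simp [revProd, orderedProd_insert _ hm]

/-- The projection onto the vacuum. -/
def vacuum [Fintype M] (b b' : M → B) : B := orderedProd (fun l => b l * b' l) Finset.univ

/-- The image of the matrix unit `|S⟩⟨T|`. -/
def matrixUnit [Fintype M] (b b' : M → B) (S T : Finset M) : B :=
  orderedProd b' S * vacuum b b' * revProd b T

lemma fermiSign_min {k : M} {T : Finset M} (h : ∀ x ∈ T, k < x) : fermiSign k T = 1 := by
  unfold fermiSign
  rw [Finset.filter_false_of_mem (fun x hx => (h x hx).not_gt)]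
  simp

namespace IsCAR

variable {b b' : M → B} (h : IsCAR b b')
include h

lemma anti_comm (k l : M) : b k * b l = -(b l * b k) := eq_neg_of_add_eq_zero_left (h.anti k l)

lemma anti_comm' (k l : M) : b' k * b' l = -(b' l * b' k) :=
  eq_neg_of_add_eq_zero_left (h.anti' k l)

lemma mixed_comm {k l : M} (hkl : k ≠ l) : b k * b' l = -(b' l * b k) :=
  eq_neg_of_add_eq_zero_left (by rw [h.mixed, if_neg hkl])

lemma mixed_self (k : M) : b k * b' k = 1 - b' k * b k := by
  rw [eq_sub_iff_add_eq, h.mixed, if_pos rfl]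

/-- Here `q` plays the role of the vacuum projection: `b k` anticommutes through all of `T` and then
meets `q`. -/
lemma annihilate_orderedProd {q : B} (hq : ∀ k, b k * q = 0) {k : M} {T : Finset M} (hk : k ∉ T) :
    b k * (orderedProd b' T * q) = 0 := by
  induction T using Finset.induction_on_min with
  | empty => simp [hq]
  | insert m T hm ih =>
    have hkT : k ∉ T := fun hx => hk (Finset.mem_insert_of_mem hx)
    have hkm : k ≠ m := fun hx => hk (hx ▸ Finset.mem_insert_self _ _)
    rw [orderedProd_insert b' hm, mul_assoc, ← mul_assoc, h.mixed_comm hkm, neg_mul, mul_assoc,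
      ih hkT, mul_zero, neg_zero]

lemma numberOp_comm {k l : M} (hkl : k ≠ l) : Commute (b k * b' k) (b' l) := by
  unfold Commute SemiconjBy
  rw [mul_assoc, h.anti_comm' k l, mul_neg, ← mul_assoc, h.mixed_comm hkl, neg_mul, neg_neg,
    mul_assoc]

lemma numberOp_comm' {k l : M} (hkl : k ≠ l) : Commute (b k * b' k) (b l) := by
  have h1 := h.mixed_comm hkl.symm
  unfold Commute SemiconjBy
  rw [mul_assoc, ← neg_eq_iff_eq_neg.2 h1, mul_neg, ← mul_assoc, h.anti_comm k l, neg_mul,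
    neg_neg, mul_assoc]

variable [Algebra ℂ B]

lemma sq (k : M) : b k * b k = 0 := by
  have h1 := h.anti k k
  rw [← two_smul ℂ, smul_eq_zero] at h1
  simpa using h1

lemma sq' (k : M) : b' k * b' k = 0 := by
  have h1 := h.anti' k k
  rw [← two_smul ℂ, smul_eq_zero] at h1
  simpa using h1

/-- Each mode of `T` below `k` that is passed costs one sign, and these signs multiply to `fermiSign
k T`. -/
lemma create_orderedProd {k : M} {T : Finset M} (hk : k ∉ T) :
    b' k * orderedProd b' T = fermiSign k T • orderedProd b' (insert k T) := by
  induction T using Finset.induction_on_min with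
  | empty =>
    rw [orderedProd_insert b' (by simp)]
    simp [fermiSign]
  | insert m T hm ih =>
    have hmT : m ∉ T := fun hx => lt_irrefl _ (hm m hx)
    have hkT : k ∉ T := fun hx => hk (Finset.mem_insert_of_mem hx)
    have hkm : k ≠ m := fun hx => hk (hx ▸ Finset.mem_insert_self _ _)
    rcases lt_or_gt_of_ne hkm with hlt | hlt
    · have hall : ∀ x ∈ insert m T, k < x := by
        intro x hx
        rcases Finset.mem_insert.1 hx with rfl | hx
        · exact hlt
        · exact hlt.trans (hm x hx)
      rw [fermiSign_min hall, one_smul, orderedProd_insert b' hall]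
    · have hall : ∀ x ∈ insert k T, m < x := by
        intro x hx
        rcases Finset.mem_insert.1 hx with rfl | hx
        · exact hlt
        · exact hm x hx
      rw [Finset.insert_comm, orderedProd_insert b' hall, orderedProd_insert b' hm,
        fermiSign_insert hmT, if_pos hlt, ← mul_assoc, h.anti_comm' k m, neg_mul, mul_assoc,
        ih hkT]
      simp

lemma create_orderedProd_mem {k : M} {T : Finset M} (hk : k ∈ T) :
    b' k * orderedProd b' T = 0 := by
  have h1 := h.create_orderedProd (Finset.notMem_erase k T)
  rw [Finset.insert_erase hk] at h1
  have h2 : orderedProd b' T = fermiSign k (T.erase k) • (b' k * orderedProd b' (T.erase k)) := by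
    rw [h1, smul_smul, fermiSign_mul_self, one_smul]
  rw [h2, mul_smul_comm, ← mul_assoc, h.sq', zero_mul, smul_zero]

lemma annihilate_orderedProd_mem {q : B} (hq : ∀ k, b k * q = 0) {k : M} {T : Finset M}
    (hk : k ∈ T) :
    b k * (orderedProd b' T * q) = fermiSign k T • (orderedProd b' (T.erase k) * q) := by
  have h1 := h.create_orderedProd (Finset.notMem_erase k T)
  rw [Finset.insert_erase hk] at h1
  have hs : fermiSign k T = fermiSign k (T.erase k) := by
    conv_lhs => rw [← Finset.insert_erase hk, fermiSign_insert (Finset.notMem_erase k T)]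
    simp
  have h2 : orderedProd b' T = fermiSign k (T.erase k) • (b' k * orderedProd b' (T.erase k)) := by
    rw [h1, smul_smul, fermiSign_mul_self, one_smul]
  rw [h2, hs, smul_mul_assoc, mul_smul_comm, mul_assoc, ← mul_assoc, h.mixed_self, sub_mul,
    one_mul, mul_assoc, h.annihilate_orderedProd hq (Finset.notMem_erase k T), mul_zero, sub_zero]

lemma vacuum_mul {k : M} {U : Finset M} (hk : k ∈ U) :
    b k * orderedProd (fun l => b l * b' l) U = 0 := by
  induction U using Finset.induction_on_min with
  | empty => simp at hk
  | insert m U hm ih =>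
    rw [orderedProd_insert _ hm, ← mul_assoc]
    rcases eq_or_ne m k with rfl | hmk
    · rw [← mul_assoc, h.sq, zero_mul, zero_mul]
    · rw [← (h.numberOp_comm' hmk).eq, mul_assoc, ih (Finset.mem_of_mem_insert_of_ne hk hmk.symm),
        mul_zero]

lemma mul_vacuum {k : M} {U : Finset M} (hk : k ∈ U) :
    orderedProd (fun l => b l * b' l) U * b' k = 0 := by
  induction U using Finset.induction_on_min with
  | empty => simp at hk
  | insert m U hm ih =>
    rw [orderedProd_insert _ hm]
    rcases eq_or_ne m k with rfl | hmk
    · have hc : Commute (b m * b' m) (orderedProd (fun l => b l * b' l) U) := by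
        apply commute_orderedProd
        intro l hl
        exact (h.numberOp_comm' (hm l hl).ne).mul_right (h.numberOp_comm (hm l hl).ne)
      rw [hc.eq, mul_assoc, mul_assoc, h.sq', mul_zero, mul_zero]
    · rw [mul_assoc, ih (Finset.mem_of_mem_insert_of_ne hk hmk.symm), mul_zero]

lemma vacuum_idem (U : Finset M) :
    orderedProd (fun l => b l * b' l) U * orderedProd (fun l => b l * b' l) U =
      orderedProd (fun l => b l * b' l) U := by
  induction U using Finset.induction_on_min with
  | empty => simp
  | insert m U hm ih =>
    have hc : Commute (b m * b' m) (orderedProd (fun l => b l * b' l) U) := by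
      apply commute_orderedProd
      intro l hl
      exact (h.numberOp_comm' (hm l hl).ne).mul_right (h.numberOp_comm (hm l hl).ne)
    have h1 : b m * b' m * (b m * b' m) = b m * b' m := by
      rw [h.mixed_self, mul_sub, mul_one, sub_mul, one_mul, mul_assoc, ← mul_assoc (b m),
        h.mixed_self, sub_mul, one_mul, mul_assoc (b' m), h.sq]
      simp
    rw [orderedProd_insert _ hm, mul_assoc, ← mul_assoc _ (b m * b' m), ← hc.eq,
      mul_assoc (b m * b' m), ih, ← mul_assoc, h1]

/-- Mode by mode this is `b b' + b' b = 1`: the subsets avoiding the smallest mode `m` sum to `b m *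
b' m`, those containing it to `b' m * b m`. -/
lemma resolution (U : Finset M) :
    ∑ T ∈ U.powerset, orderedProd b' T * orderedProd (fun l => b l * b' l) U * revProd b T = 1 := by
  induction U using Finset.induction_on_min with
  | empty => simp
  | insert m U hm ih =>
    have hmU : m ∉ U := fun hx => lt_irrefl _ (hm m hx)
    have hc : ∀ T ∈ U.powerset, Commute (b m * b' m) (orderedProd b' T) := by
      intro T hT
      apply commute_orderedProd
      intro l hl
      exact h.numberOp_comm (hm l (Finset.mem_powerset.1 hT hl)).ne
    rw [Finset.sum_powerset_insert hmU, orderedProd_insert _ hm]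
    have e1 : ∑ T ∈ U.powerset, orderedProd b' T *
        (b m * b' m * orderedProd (fun l => b l * b' l) U) * revProd b T = b m * b' m := by
      conv_rhs => rw [← mul_one (b m * b' m), ← ih, Finset.mul_sum]
      refine Finset.sum_congr rfl fun T hT => ?_
      rw [← mul_assoc (orderedProd b' T), ← (hc T hT).eq]
      simp only [mul_assoc]
    have e2 : ∑ T ∈ U.powerset, orderedProd b' (insert m T) *
        (b m * b' m * orderedProd (fun l => b l * b' l) U) * revProd b (insert m T) =
        b' m * b m := by
      have h1 : b' m * b m = b' m * (b m * b' m) * b m := by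
        rw [h.mixed_self, mul_sub, ← mul_assoc (b' m) (b' m), h.sq']; simp
      conv_rhs => rw [h1, ← mul_one (b' m * (b m * b' m)), ← ih, Finset.mul_sum, Finset.sum_mul]
      refine Finset.sum_congr rfl fun T hT => ?_
      have hT' : ∀ x ∈ T, m < x := fun x hx => hm x (Finset.mem_powerset.1 hT hx)
      rw [orderedProd_insert _ hT', revProd_insert _ hT', mul_assoc (b' m),
        ← mul_assoc (orderedProd b' T), ← (hc T hT).eq]
      simp only [mul_assoc]
    rw [e1, e2, h.mixed, if_pos rfl]

/-! ### Matrix units and the universal property of Fock space -/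

section Universal

variable [Fintype M]

lemma annihilate_vacuum (k : M) : b k * vacuum b b' = 0 := h.vacuum_mul (Finset.mem_univ k)

lemma vacuum_create (k : M) : vacuum b b' * b' k = 0 := h.mul_vacuum (Finset.mem_univ k)

/-- Orthonormality of the occupation states; together with `resolution` it makes the `matrixUnit`s a
complete system of matrix units. -/
lemma vacuum_orderedProd (T U : Finset M) :
    vacuum b b' * revProd b T * (orderedProd b' U * vacuum b b') =
      if T = U then vacuum b b' else 0 := by
  induction T using Finset.induction_on_min generalizing U with
  | empty =>
    rw [revProd_empty, mul_one]
    induction U using Finset.induction_on_min with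
    | empty =>
      rw [orderedProd_empty, one_mul, if_pos rfl]
      exact h.vacuum_idem _
    | insert m U hm _ =>
      rw [orderedProd_insert _ hm, ← mul_assoc, ← mul_assoc, h.vacuum_create,
        if_neg (Finset.insert_ne_empty _ _).symm]
      simp
  | insert m T hm ih =>
    rw [revProd_insert _ hm, ← mul_assoc (vacuum b b'), mul_assoc _ (b m)]
    have hmT : m ∉ T := fun hx => lt_irrefl _ (hm m hx)
    by_cases hU : m ∈ U
    · rw [h.annihilate_orderedProd_mem h.annihilate_vacuum hU, mul_smul_comm, ih]
      by_cases hTU : T = U.erase m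
      · have : insert m T = U := by rw [hTU, Finset.insert_erase hU]
        rw [if_pos hTU, if_pos this, ← this, fermiSign_insert hmT, fermiSign_min hm]
        simp
      · have : insert m T ≠ U := by rintro rfl; exact hTU (Finset.erase_insert hmT).symm
        rw [if_neg hTU, if_neg this, smul_zero]
    · have : insert m T ≠ U := by rintro rfl; exact hU (Finset.mem_insert_self _ _)
      rw [h.annihilate_orderedProd h.annihilate_vacuum hU, mul_zero, if_neg this]

lemma matrixUnit_mul (S T U V : Finset M) :
    matrixUnit b b' S T * matrixUnit b b' U V = if T = U then matrixUnit b b' S V else 0 := by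
  have h1 : matrixUnit b b' S T * matrixUnit b b' U V = orderedProd b' S *
      (vacuum b b' * revProd b T * (orderedProd b' U * vacuum b b')) * revProd b V := by
    simp only [matrixUnit, mul_assoc]
  rw [h1, h.vacuum_orderedProd]
  split_ifs <;> simp [matrixUnit]

lemma sum_matrixUnit : ∑ T, matrixUnit b b' T T = 1 := by
  rw [← h.resolution Finset.univ]; rfl

/-- The algebra homomorphism from the operators on Fock space given by a representation of the
canonical anticommutation relations. -/
def lift : Matrix (Finset M) (Finset M) ℂ →ₐ[ℂ] B :=
  AlgHom.ofLinearMap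
    { toFun := fun X => ∑ S, ∑ T, X S T • matrixUnit b b' S T
      map_add' := fun X Y => by simp [add_smul, Finset.sum_add_distrib]
      map_smul' := fun c X => by simp [Finset.smul_sum, mul_smul] }
    (by
      simp only [LinearMap.coe_mk, AddHom.coe_mk, Matrix.one_apply, ite_smul, one_smul, zero_smul,
        Finset.sum_ite_eq, Finset.mem_univ, if_true]
      exact h.sum_matrixUnit)
    (fun X Y => by
      simp only [LinearMap.coe_mk, AddHom.coe_mk, Matrix.mul_apply, Finset.sum_mul_sum,
        Finset.sum_smul, smul_mul_smul_comm, h.matrixUnit_mul, smul_ite, smul_zero]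
      refine Finset.sum_congr rfl fun S _ => ?_
      rw [Finset.sum_comm]
      conv_rhs => rw [Finset.sum_comm]
      have : ∀ (j U : Finset M), ∑ x, (if j = U then (X S j * Y U x) • matrixUnit b b' S x else 0)
          = if j = U then ∑ x, (X S j * Y U x) • matrixUnit b b' S x else 0 := by
        intro j U; split_ifs <;> simp
      simp only [this, Finset.sum_ite_eq, Finset.mem_univ, if_true])

lemma lift_apply (X : Matrix (Finset M) (Finset M) ℂ) :
    h.lift X = ∑ S, ∑ T, X S T • matrixUnit b b' S T := rfl

lemma lift_annihilate (k : M) : h.lift (annihilate k) = b k := by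
  rw [lift_apply, Finset.sum_comm]
  conv_rhs => rw [← mul_one (b k), ← h.sum_matrixUnit, Finset.mul_sum]
  refine Finset.sum_congr rfl fun T _ => ?_
  rw [matrixUnit, ← mul_assoc]
  by_cases hk : k ∈ T
  · rw [h.annihilate_orderedProd_mem h.annihilate_vacuum hk, Finset.sum_eq_single (T.erase k)]
    · simp [annihilate, hk, matrixUnit]
    · intro S _ hS; simp [annihilate, hS]
    · simp
  · rw [h.annihilate_orderedProd h.annihilate_vacuum hk, zero_mul]
    refine Finset.sum_eq_zero fun S _ => ?_
    simp [annihilate, hk]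

lemma lift_create (k : M) : h.lift (annihilate k)ᴴ = b' k := by
  rw [lift_apply, Finset.sum_comm]
  conv_rhs => rw [← mul_one (b' k), ← h.sum_matrixUnit, Finset.mul_sum]
  refine Finset.sum_congr rfl fun T _ => ?_
  rw [matrixUnit, ← mul_assoc, ← mul_assoc]
  by_cases hk : k ∈ T
  · rw [h.create_orderedProd_mem hk, zero_mul, zero_mul]
    refine Finset.sum_eq_zero fun S _ => ?_
    have : ¬ (k ∈ S ∧ T = S.erase k) := by rintro ⟨_, rfl⟩; simp at hk
    simp [annihilate, this]
  · rw [h.create_orderedProd hk, Finset.sum_eq_single (insert k T)]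
    · simp [annihilate, hk, matrixUnit, fermiSign_insert hk, star_fermiSign]
    · intro S _ hS
      have : ¬ (k ∈ S ∧ T = S.erase k) := by
        rintro ⟨h1, rfl⟩; exact hS (Finset.insert_erase h1).symm
      simp [annihilate, this]
    · simp

end Universal

end IsCAR

end CAR

/-! ### Reflection positivity -/

/-! ### A product formula for the exponential -/

section Exponential

open Filter Topology

variable {A : Type*} [NormedRing A] [NormOneClass A]

lemma norm_pow_sub_pow_le {a b : A} {c : ℝ} (hc : 1 ≤ c) (ha : ‖a‖ ≤ c) (hb : ‖b‖ ≤ c) (n : ℕ) :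
    ‖a ^ n - b ^ n‖ ≤ n * c ^ n * ‖a - b‖ := by
  have hc0 : 0 ≤ c := zero_le_one.trans hc
  induction n with
  | zero => simp
  | succ n ih =>
    have e : a ^ (n + 1) - b ^ (n + 1) = a ^ n * (a - b) + (a ^ n - b ^ n) * b := by
      rw [pow_succ, pow_succ]; noncomm_ring
    have h1 : ‖a ^ n * (a - b)‖ ≤ c ^ n * ‖a - b‖ :=
      (norm_mul_le _ _).trans (by gcongr; exact (norm_pow_le _ _).trans (by gcongr))
    have h2 : ‖(a ^ n - b ^ n) * b‖ ≤ n * c ^ n * ‖a - b‖ * c :=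
      (norm_mul_le _ _).trans (by gcongr)
    have h3 : c ^ n * ‖a - b‖ ≤ c ^ n * c * ‖a - b‖ := by
      gcongr; exact le_mul_of_one_le_right (by positivity) hc
    rw [e]
    refine (norm_add_le _ _).trans ((add_le_add (h1.trans h3) h2).trans (le_of_eq ?_))
    push_cast; ring

variable [NormedAlgebra ℝ A]

/-- The bases have norm at most `1 + K/n`, so the `n`-th power has Lipschitz constant at most `n *
exp K` there; the bases differ by `(x n - y n)/n`, which cancels the `n`. -/
lemma tendsto_one_add_pow_sub {x y : ℕ → A} {a : A} (hx : Tendsto x atTop (𝓝 a))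
    (hy : Tendsto y atTop (𝓝 a)) :
    Tendsto (fun n : ℕ => (1 + (n : ℝ)⁻¹ • x n) ^ n - (1 + (n : ℝ)⁻¹ • y n) ^ n) atTop (𝓝 0) := by
  obtain ⟨K, hK⟩ : ∃ K : ℝ, ‖a‖ < K := exists_gt _
  have hK0 : 0 ≤ K := (norm_nonneg a).trans hK.le
  have hx' : ∀ᶠ n in atTop, ‖x n‖ < K := hx.norm.eventually_lt_const hK
  have hy' : ∀ᶠ n in atTop, ‖y n‖ < K := hy.norm.eventually_lt_const hK
  have hlim : Tendsto (fun n => Real.exp K * ‖x n - y n‖) atTop (𝓝 0) := by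
    simpa using ((hx.sub hy).norm).const_mul (Real.exp K)
  refine squeeze_zero_norm' ?_ hlim
  filter_upwards [hx', hy', eventually_gt_atTop 0] with n h1 h2 hn
  have hn' : (0 : ℝ) < n := by exact_mod_cast hn
  have bound : ∀ z : A, ‖z‖ < K → ‖1 + (n : ℝ)⁻¹ • z‖ ≤ 1 + K / n := by
    intro z hz
    refine (norm_add_le _ _).trans ?_
    rw [norm_one, norm_smul, norm_inv, Real.norm_natCast, div_eq_inv_mul]
    gcongr
  have hpow : (1 + K / n) ^ n ≤ Real.exp K := by
    calc (1 + K / n) ^ n ≤ Real.exp (K / n) ^ n := by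
          gcongr; rw [add_comm]; exact Real.add_one_le_exp _
      _ = Real.exp K := by rw [← Real.exp_nat_mul]; congr 1; field_simp
  refine (norm_pow_sub_pow_le (c := 1 + K / n) (le_add_of_nonneg_right (by positivity))
    (bound _ h1) (bound _ h2) n).trans ?_
  rw [add_sub_add_left_eq_sub, ← smul_sub, norm_smul, norm_inv, Real.norm_natCast]
  calc n * (1 + K / n) ^ n * ((n : ℝ)⁻¹ * ‖x n - y n‖) = (1 + K / n) ^ n * ‖x n - y n‖ := by
        field_simp
    _ ≤ _ := by gcongr

lemma tendsto_one_add_pow_exp [CompleteSpace A] {x : ℕ → A} {a : A} (hx : Tendsto x atTop (𝓝 a)) :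
    Tendsto (fun n : ℕ => (1 + (n : ℝ)⁻¹ • x n) ^ n) atTop (𝓝 (NormedSpace.exp a)) := by
  let _ : NormedAlgebra ℚ A := NormedAlgebra.restrictScalars ℚ ℝ A
  have hd : HasDerivAt (fun t : ℝ => NormedSpace.exp (t • a)) a 0 := by
    simpa using hasDerivAt_exp_smul_const (𝕂 := ℝ) a (0 : ℝ)
  have ht : Tendsto (fun n : ℕ => (n : ℝ)⁻¹) atTop (𝓝[≠] 0) := by
    refine tendsto_nhdsWithin_iff.2 ⟨tendsto_inv_atTop_nhds_zero_nat, ?_⟩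
    filter_upwards [eventually_gt_atTop 0] with n hn
    simp [hn.ne']
  -- The comparison sequence is `n (exp(a/n) - 1)`: it tends to `a`, and its product is exactly `exp
  -- a` for every positive `n`.
  have hy := (hasDerivAt_iff_tendsto_slope.1 hd).comp ht
  have hlim := (tendsto_one_add_pow_sub hx hy).add_const (NormedSpace.exp a)
  rw [zero_add] at hlim
  refine hlim.congr' ?_
  filter_upwards [eventually_gt_atTop 0] with n hn
  have hn' : (n : ℝ) ≠ 0 := by exact_mod_cast hn.ne'
  have e : 1 + (n : ℝ)⁻¹ • (slope (fun t : ℝ => NormedSpace.exp (t • a)) 0 ∘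
      fun n : ℕ => (n : ℝ)⁻¹) n = NormedSpace.exp ((n : ℝ)⁻¹ • a) := by
    simp [slope, vsub_eq_sub, smul_smul, hn']
  rw [e, ← NormedSpace.exp_nsmul, ← Nat.cast_smul_eq_nsmul ℝ, smul_smul, mul_inv_cancel₀ hn',
    one_smul, sub_add_cancel]

end Exponential

/-! ### Cauchy-Schwarz for reflected products -/

section Positivity

open Filter Topology

variable {F A : Type*} [Ring F] [Algebra ℝ F]

section Algebraic

variable [Ring A] [Algebra ℝ A] (i j : F →ₐ[ℝ] A)

/-- `X`, `Y` and `Z` are of the form `∑ i(Pₖ) j(Qₖ)`, `∑ i(Pₖ) j(Pₖ)` and `∑ i(Qₖ) j(Qₖ)`. -/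
def ReflectionTriple (X Y Z : A) : Prop :=
  ∃ (ι : Type) (_ : Fintype ι) (P Q : ι → F),
    X = ∑ k, i (P k) * j (Q k) ∧ Y = ∑ k, i (P k) * j (P k) ∧ Z = ∑ k, i (Q k) * j (Q k)

namespace ReflectionTriple

variable {i j}

lemma of_mul (p q : F) : ReflectionTriple i j (i p * j q) (i p * j p) (i q * j q) :=
  ⟨Unit, inferInstance, fun _ => p, fun _ => q, by simp, by simp, by simp⟩

lemma zero : ReflectionTriple i j 0 0 0 :=
  ⟨Empty, inferInstance, fun _ => 0, fun _ => 0, by simp, by simp, by simp⟩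

lemma one : ReflectionTriple i j 1 1 1 := by
  simpa using of_mul (i := i) (j := j) 1 1

lemma add {X Y Z X' Y' Z' : A} (h : ReflectionTriple i j X Y Z)
    (h' : ReflectionTriple i j X' Y' Z') : ReflectionTriple i j (X + X') (Y + Y') (Z + Z') := by
  obtain ⟨ι, _, P, Q, rfl, rfl, rfl⟩ := h
  obtain ⟨ι', _, P', Q', rfl, rfl, rfl⟩ := h'
  exact ⟨ι ⊕ ι', inferInstance, Sum.elim P P', Sum.elim Q Q', by simp, by simp, by simp⟩

lemma sum {κ : Type*} (s : Finset κ) {X Y Z : κ → A}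
    (h : ∀ k ∈ s, ReflectionTriple i j (X k) (Y k) (Z k)) :
    ReflectionTriple i j (∑ k ∈ s, X k) (∑ k ∈ s, Y k) (∑ k ∈ s, Z k) := by
  classical
  induction s using Finset.induction_on with
  | empty => simpa using zero
  | insert a s ha ih =>
    simp only [Finset.sum_insert ha]
    exact (h a (Finset.mem_insert_self _ _)).add
      (ih fun k hk => h k (Finset.mem_insert_of_mem hk))

/-- The scalar is split as `√c * √c` between the two sides, because the same families `P`, `Q` must
serve all three sums. This is where the signs of the couplings matter. -/
lemma smul {c : ℝ} (hc : 0 ≤ c) {X Y Z : A} (h : ReflectionTriple i j X Y Z) :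
    ReflectionTriple i j (c • X) (c • Y) (c • Z) := by
  obtain ⟨ι, _, P, Q, rfl, rfl, rfl⟩ := h
  refine ⟨ι, inferInstance, fun k => √c • P k, fun k => √c • Q k, ?_, ?_, ?_⟩ <;>
  simp only [Finset.smul_sum, map_smul, smul_mul_smul_comm, Real.mul_self_sqrt hc]

lemma mul (hij : ∀ u v, Commute (i u) (j v)) {X Y Z X' Y' Z' : A} (h : ReflectionTriple i j X Y Z)
    (h' : ReflectionTriple i j X' Y' Z') : ReflectionTriple i j (X * X') (Y * Y') (Z * Z') := by
  obtain ⟨ι, _, P, Q, rfl, rfl, rfl⟩ := h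
  obtain ⟨ι', _, P', Q', rfl, rfl, rfl⟩ := h'
  have key : ∀ a b c d, i a * j b * (i c * j d) = i (a * c) * j (b * d) := by
    intro a b c d
    rw [map_mul, map_mul, mul_assoc, ← mul_assoc (j b), ← (hij c b).eq]
    simp only [mul_assoc]
  refine ⟨ι × ι', inferInstance, fun k => P k.1 * P' k.2, fun k => Q k.1 * Q' k.2, ?_, ?_, ?_⟩ <;>
  simp only [Finset.sum_mul_sum, key, Fintype.sum_prod_type]

lemma pow (hij : ∀ u v, Commute (i u) (j v)) {X Y Z : A} (h : ReflectionTriple i j X Y Z) (n : ℕ) :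
    ReflectionTriple i j (X ^ n) (Y ^ n) (Z ^ n) := by
  induction n with
  | zero => simpa using one
  | succ n ih => simpa only [pow_succ] using ih.mul hij h

/-- The functional turns the three sums into `c` times an inner product of the vectors `t (P k)`, `t
(Q k)` and their squared norms; Cauchy-Schwarz concludes. -/
lemma norm_sq_le {T : A →ₗ[ℝ] ℂ} {t : F → ℂ} {c : ℝ} (hc : 0 ≤ c)
    (hT : ∀ u v, T (i u * j v) = c * (t u * star (t v)))
    {X Y Z : A} (h : ReflectionTriple i j X Y Z) : ‖T X‖ ^ 2 ≤ ‖T Y‖ * ‖T Z‖ := by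
  obtain ⟨ι, _, P, Q, rfl, rfl, rfl⟩ := h
  have hself : ∀ R : ι → F, ‖T (∑ k, i (R k) * j (R k))‖ = c * ∑ k, ‖t (R k)‖ ^ 2 := by
    intro R
    have : T (∑ k, i (R k) * j (R k)) = ((c * ∑ k, ‖t (R k)‖ ^ 2 : ℝ) : ℂ) := by
      simp only [map_sum, hT, ← Finset.mul_sum]
      push_cast
      congr 1
      exact Finset.sum_congr rfl fun k _ => Complex.mul_conj' _
    rw [this, Complex.norm_real, Real.norm_of_nonneg]
    positivity
  have hmix : ‖T (∑ k, i (P k) * j (Q k))‖ ≤ c * ∑ k, ‖t (P k)‖ * ‖t (Q k)‖ := by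
    simp only [map_sum, hT, ← Finset.mul_sum]
    rw [norm_mul, Complex.norm_real, Real.norm_of_nonneg hc]
    gcongr
    refine (norm_sum_le _ _).trans (le_of_eq ?_)
    simp
  rw [hself, hself]
  calc ‖T (∑ k, i (P k) * j (Q k))‖ ^ 2 ≤ (c * ∑ k, ‖t (P k)‖ * ‖t (Q k)‖) ^ 2 := by gcongr
    _ = c ^ 2 * (∑ k, ‖t (P k)‖ * ‖t (Q k)‖) ^ 2 := by ring
    _ ≤ c ^ 2 * ((∑ k, ‖t (P k)‖ ^ 2) * ∑ k, ‖t (Q k)‖ ^ 2) := by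
      gcongr; exact Finset.sum_mul_sq_le_sq_mul_sq _ _ _
    _ = _ := by ring

end ReflectionTriple

end Algebraic

/-- The trace inequality of Dyson, Lieb and Simon. -/
theorem ReflectionTriple.norm_exp_sq_le [NormedRing A] [NormedAlgebra ℝ A] [NormOneClass A]
    [CompleteSpace A] {i j : F →ₐ[ℝ] A} (hij : ∀ u v, Commute (i u) (j v))
    {T : A →L[ℝ] ℂ} {t : F → ℂ} {c : ℝ} (hc : 0 ≤ c)
    (hT : ∀ u v, T (i u * j v) = c * (t u * star (t v)))
    {X Y Z : A} (h : ReflectionTriple i j X Y Z) (a b : F) :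
    ‖T (NormedSpace.exp (i a + j b + X))‖ ^ 2 ≤
      ‖T (NormedSpace.exp (i a + j a + Y))‖ * ‖T (NormedSpace.exp (i b + j b + Z))‖ := by
  have lim : ∀ (a b : F) (X : A), Tendsto (fun n : ℕ =>
      ‖T ((i (1 + (n : ℝ)⁻¹ • a) * j (1 + (n : ℝ)⁻¹ • b) + (n : ℝ)⁻¹ • X) ^ n)‖) atTop
      (𝓝 ‖T (NormedSpace.exp (i a + j b + X))‖) := by
    intro a b X
    -- The correction `(i a * j b)/n` is what turns `1 + (i a + j b)/n` into the product `i (1 +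
    -- a/n) * j (1 + b/n)`, so that each factor lies in the cone of reflection triples.
    have hx : Tendsto (fun n : ℕ => i a + j b + X + (n : ℝ)⁻¹ • (i a * j b)) atTop
        (𝓝 (i a + j b + X)) := by
      simpa using tendsto_const_nhds.add
        ((tendsto_inv_atTop_nhds_zero_nat (𝕜 := ℝ)).smul_const (i a * j b))
    have hp := ((T.continuous.tendsto _).comp (tendsto_one_add_pow_exp hx)).norm
    refine hp.congr fun n => ?_
    simp only [Function.comp]
    congr 3
    simp only [map_add, map_one, map_smul, mul_add, add_mul, one_mul, mul_one, smul_add,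
      smul_mul_assoc, mul_smul_comm]
    abel
  refine le_of_tendsto_of_tendsto' ((lim a b X).pow 2) ((lim a a Y).mul (lim b b Z)) fun n => ?_
  exact (((of_mul _ _).add (h.smul (by positivity))).pow hij n).norm_sq_le
    (T := T.toLinearMap) hc hT

end Positivity

/-! ### Factorization of the trace over commuting matrix algebras -/

section Trace

variable {n : Type*} [Fintype n] [DecidableEq n]

/-- A tracial functional on a matrix algebra is a multiple of the trace. -/
lemma card_mul_of_tracial (f : Matrix n n ℂ →ₗ[ℂ] ℂ) (hf : ∀ X Y, f (X * Y) = f (Y * X))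
    (X : Matrix n n ℂ) : (Fintype.card n : ℂ) * f X = X.trace * f 1 := by
  have off : ∀ a b : n, a ≠ b → f (Matrix.single a b 1) = 0 := by
    intro a b hab
    have := hf (Matrix.single a b 1) (Matrix.single b b 1)
    rw [Matrix.single_mul_single_same, Matrix.single_mul_single_of_ne _ _ _ _ hab.symm] at this
    simpa using this
  have diag : ∀ a b : n, f (Matrix.single a a 1) = f (Matrix.single b b 1) := by
    intro a b
    have := hf (Matrix.single a b 1) (Matrix.single b a 1)
    simpa using this
  have hX : ∀ X : Matrix n n ℂ, f X = ∑ a, X a a * f (Matrix.single a a 1) := by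
    intro X
    conv_lhs => rw [Matrix.matrix_eq_sum_single X, map_sum]
    refine Finset.sum_congr rfl fun a _ => ?_
    have hs : ∀ b, Matrix.single a b (X a b) = X a b • Matrix.single a b (1 : ℂ) := by
      intro b; simp [Matrix.smul_single]
    rw [map_sum, Finset.sum_eq_single a]
    · rw [hs, map_smul, smul_eq_mul]
    · intro b _ hb
      rw [hs, map_smul, off a b hb.symm, smul_zero]
    · simp
  rw [hX X, hX 1, Finset.mul_sum, Matrix.trace, Finset.sum_mul]
  refine Finset.sum_congr rfl fun a _ => ?_
  have : ∑ b, (1 : Matrix n n ℂ) b b * f (Matrix.single b b 1) =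
      Fintype.card n * f (Matrix.single a a 1) := by
    simp [diag _ a]
  rw [this, Matrix.diag_apply]
  ring

/-- The trace factorizes over commuting matrix algebras. -/
lemma trace_mul_of_commute {m : Type*} [Fintype m] [DecidableEq m] [Nonempty n]
    (i j : Matrix n n ℂ →ₐ[ℂ] Matrix m m ℂ) (hij : ∀ u v, Commute (i u) (j v))
    (u v : Matrix n n ℂ) :
    (i u * j v).trace =
      ((Fintype.card m / (Fintype.card n : ℝ) ^ 2 : ℝ) : ℂ) * (u.trace * v.trace) := by
  let f (v : Matrix n n ℂ) : Matrix n n ℂ →ₗ[ℂ] ℂ :=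
    Matrix.traceLinearMap m ℂ ℂ ∘ₗ LinearMap.mulRight ℂ (j v) ∘ₗ i.toLinearMap
  let g : Matrix n n ℂ →ₗ[ℂ] ℂ := Matrix.traceLinearMap m ℂ ℂ ∘ₗ j.toLinearMap
  -- For fixed `v` the functional `u ↦ tr (i u * j v)` is tracial, because `j v` commutes with the
  -- range of `i`.
  have hf : (Fintype.card n : ℂ) * (i u * j v).trace = u.trace * (j v).trace := by
    have := card_mul_of_tracial (f v) (fun X Y => by
      simp only [f, LinearMap.comp_apply, AlgHom.toLinearMap_apply, LinearMap.mulRight_apply,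
        Matrix.traceLinearMap_apply, map_mul]
      rw [mul_assoc, Matrix.trace_mul_comm, mul_assoc, mul_assoc, (hij X v).eq]) u
    simpa [f] using this
  have hg : (Fintype.card n : ℂ) * (j v).trace = v.trace * Fintype.card m := by
    have := card_mul_of_tracial g (fun X Y => by
      simp only [g, LinearMap.comp_apply, AlgHom.toLinearMap_apply,
        Matrix.traceLinearMap_apply, map_mul]
      rw [Matrix.trace_mul_comm]) v
    simpa [g] using this
  have hn : (Fintype.card n : ℂ) ≠ 0 := by exact_mod_cast Fintype.card_ne_zero
  push_cast
  field_simp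
  linear_combination (Fintype.card n : ℂ) * hf + u.trace * hg

end Trace

/-! ### Reflections of the Fock space -/

section LiftCommute

variable {M : Type*} [LinearOrder M] {B : Type*} [Ring B]

lemma commute_revProd {x : B} {f : M → B} {T : Finset M} (hx : ∀ k ∈ T, Commute x (f k)) :
    Commute x (revProd f T) := by
  have := (commute_orderedProd (x := MulOpposite.op x) (f := fun k => MulOpposite.op (f k))
    (T := T) fun k hk => (hx k hk).op).unop
  exact this

variable [Fintype M] [Algebra ℂ B]

lemma IsCAR.commute_lift {b b' : M → B} (h : IsCAR b b') {x : B} (hb : ∀ k, Commute x (b k))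
    (hb' : ∀ k, Commute x (b' k)) (X : Matrix (Finset M) (Finset M) ℂ) : Commute x (h.lift X) := by
  rw [h.lift_apply]
  refine Commute.sum_right _ _ _ fun S _ => Commute.sum_right _ _ _ fun T _ =>
    Commute.smul_right ?_ _
  refine ((commute_orderedProd fun k _ => hb' k).mul_right
    (commute_orderedProd fun k _ => (hb k).mul_right (hb' k))).mul_right
    (commute_revProd fun k _ => hb k)

end LiftCommute

/-! ### Complex conjugation and the trace inequality for matrices -/

section Conj

variable (n : Type*) [Fintype n] [DecidableEq n]

/-- Entrywise complex conjugation of matrices. -/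
def conjMatrix : Matrix n n ℂ →ₐ[ℝ] Matrix n n ℂ := (Complex.conjAe : ℂ →ₐ[ℝ] ℂ).mapMatrix

variable {n}

lemma conjMatrix_apply (X : Matrix n n ℂ) (a b : n) : conjMatrix n X a b = star (X a b) := rfl

lemma conjMatrix_smul (c : ℂ) (X : Matrix n n ℂ) :
    conjMatrix n (c • X) = star c • conjMatrix n X := by
  ext a b; simp [conjMatrix_apply]

lemma trace_conjMatrix (X : Matrix n n ℂ) : (conjMatrix n X).trace = star X.trace := by
  simp [Matrix.trace, conjMatrix_apply]

section Exp

variable {m : Type*} [Fintype m] [DecidableEq m] [Nonempty n] [Nonempty m]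

attribute [local instance] Matrix.linftyOpNormedRing Matrix.linftyOpNormedAlgebra in
/-- Reflection positivity for a pair of commuting matrix algebras, the second one of which is
identified with the first one by an antilinear map. -/
theorem norm_trace_exp_sq_le (i j : Matrix n n ℂ →ₐ[ℂ] Matrix m m ℂ)
    (hij : ∀ u v, Commute (i u) (j v)) {X Y Z : Matrix m m ℂ}
    (h : ReflectionTriple (i.restrictScalars ℝ) ((j.restrictScalars ℝ).comp (conjMatrix n)) X Y Z)
    (a b : Matrix n n ℂ) :
    ‖(NormedSpace.exp (i a + j (conjMatrix n b) + X)).trace‖ ^ 2 ≤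
      ‖(NormedSpace.exp (i a + j (conjMatrix n a) + Y)).trace‖ *
        ‖(NormedSpace.exp (i b + j (conjMatrix n b) + Z)).trace‖ := by
  have : NormOneClass (Matrix m m ℂ) := Matrix.linfty_opNormOneClass
  let T : Matrix m m ℂ →L[ℝ] ℂ := LinearMap.toContinuousLinearMap (Matrix.traceLinearMap m ℝ ℂ)
  refine h.norm_exp_sq_le (T := T) (t := Matrix.trace)
    (c := Fintype.card m / (Fintype.card n : ℝ) ^ 2) (fun u v => hij _ _) (by positivity)
    (fun u v => ?_) a b
  have := trace_mul_of_commute i j hij u (conjMatrix n v)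
  rw [trace_conjMatrix] at this
  exact this

end Exp

end Conj

/-! ### Klein transformations -/

section Parity

variable {M : Type*} [LinearOrder M] (left : M → Prop) [DecidablePred left]

/-- The fermion parity of the modes in `left`. -/
def parity : Matrix (Finset M) (Finset M) ℂ :=
  Matrix.diagonal fun T => (-1) ^ (T.filter left).card

lemma conjTranspose_parity : (parity left)ᴴ = parity left := by
  rw [parity, Matrix.diagonal_conjTranspose]
  congr 1
  ext T
  simp

/-- The entries in the occupation basis are `0` or `±1`, so conjugation affects only scalar
coefficients. -/
lemma conjMatrix_annihilate [Fintype M] [DecidableEq (Finset M)] (k : M) :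
    conjMatrix _ (annihilate k) = annihilate k := by
  ext S T
  rw [conjMatrix_apply, annihilate, Matrix.of_apply, apply_ite star, star_fermiSign, star_zero]

lemma conjMatrix_create [Fintype M] [DecidableEq (Finset M)] (k : M) :
    conjMatrix _ (annihilate k)ᴴ = (annihilate k)ᴴ := by
  ext S T
  rw [conjMatrix_apply, Matrix.conjTranspose_apply, annihilate, Matrix.of_apply,
    apply_ite star, star_fermiSign, star_zero, apply_ite star, star_fermiSign, star_zero]

variable [Fintype M]

lemma isCAR_annihilate : IsCAR (annihilate : M → _) fun k => (annihilate k)ᴴ where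
  anti := annihilate_anticomm
  anti' k l := by
    rw [← Matrix.conjTranspose_mul, ← Matrix.conjTranspose_mul, ← Matrix.conjTranspose_add,
      annihilate_anticomm, Matrix.conjTranspose_zero]
  mixed := annihilate_anticomm_conjTranspose

lemma parity_mul_self : parity left * parity left = 1 := by
  rw [parity, Matrix.diagonal_mul_diagonal, ← Matrix.diagonal_one]
  congr 1
  ext T
  rw [← mul_pow]; simp

lemma parity_annihilate (k : M) :
    parity left * annihilate k = (if left k then (-1 : ℂ) else 1) • (annihilate k * parity left) := by
  ext S T
  rw [Matrix.smul_apply, parity, Matrix.diagonal_mul, Matrix.mul_diagonal, annihilate,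
    Matrix.of_apply]
  by_cases h : k ∈ T ∧ S = T.erase k
  swap
  · simp [h]
  obtain ⟨hk, rfl⟩ := h
  rw [if_pos ⟨hk, rfl⟩, Finset.filter_erase]
  split_ifs with hl
  · have hm : k ∈ T.filter left := Finset.mem_filter.2 ⟨hk, hl⟩
    rw [← Finset.card_erase_add_one hm, pow_succ]
    simp; ring
  · rw [Finset.erase_eq_of_notMem (by simp [hl])]
    simp [mul_comm]

lemma parity_annihilate_of_left {k : M} (hk : left k) :
    parity left * annihilate k = -(annihilate k * parity left) := by
  rw [parity_annihilate, if_pos hk, neg_one_smul]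

lemma parity_annihilate_of_right {k : M} (hk : ¬ left k) :
    parity left * annihilate k = annihilate k * parity left := by
  rw [parity_annihilate, if_neg hk, one_smul]

lemma parity_create_of_left {k : M} (hk : left k) :
    parity left * (annihilate k)ᴴ = -((annihilate k)ᴴ * parity left) := by
  have := congrArg Matrix.conjTranspose (parity_annihilate_of_left left hk)
  rw [Matrix.conjTranspose_neg, Matrix.conjTranspose_mul, Matrix.conjTranspose_mul,
    conjTranspose_parity] at this
  rw [this, neg_neg]

lemma parity_create_of_right {k : M} (hk : ¬ left k) :
    parity left * (annihilate k)ᴴ = (annihilate k)ᴴ * parity left := by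
  have := congrArg Matrix.conjTranspose (parity_annihilate_of_right left hk)
  rw [Matrix.conjTranspose_mul, Matrix.conjTranspose_mul, conjTranspose_parity] at this
  exact this.symm

lemma mul_mul_of_anticomm {R : Type*} [Ring R] {p x : R} (y : R) (hp : p * p = 1)
    (hx : p * x = -(x * p)) : p * x * (p * y) = -(x * y) := by
  rw [hx, neg_mul, mul_assoc, ← mul_assoc p p, hp, one_mul]

lemma mul_mul_of_comm {R : Type*} [Ring R] {p x : R} (y : R) (hp : p * p = 1)
    (hx : p * x = x * p) : p * x * (p * y) = x * y := by
  rw [hx, mul_assoc, ← mul_assoc p p, hp, one_mul]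

/-- Parity anticommutes with left modes, so inserting it in both factors of a product produces `-1`;
the factor `I` in each generator undoes this. -/
lemma isCAR_left : IsCAR (fun k : {k // left k} => Complex.I • (parity left * annihilate k.1))
    fun k => Complex.I • (parity left * (annihilate k.1)ᴴ) := by
  have hp := parity_mul_self left
  refine ⟨fun k l => ?_, fun k l => ?_, fun k l => ?_⟩ <;>
  simp only [smul_mul_smul_comm, Complex.I_mul_I,
    mul_mul_of_anticomm _ hp (parity_annihilate_of_left left (Subtype.prop _)),
    mul_mul_of_anticomm _ hp (parity_create_of_left left (Subtype.prop _)), neg_one_smul, neg_neg]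
  · exact isCAR_annihilate.anti _ _
  · exact isCAR_annihilate.anti' _ _
  · rw [isCAR_annihilate.mixed]
    simp [Subtype.ext_iff]

variable {left} {r : M → M} {σ : M → ℝ}

/-- Parity commutes with right modes, so no factor `I` is needed. Creation and annihilation are
interchanged: this is the particle-hole transformation. -/
lemma isCAR_right (hr : ∀ k, left k → ¬ left (r k)) (hinj : Function.Injective r)
    (hσ : ∀ k, σ k * σ k = 1) :
    IsCAR (fun k : {k // left k} => (σ k : ℂ) • (parity left * (annihilate (r k.1))ᴴ))
    fun k => (σ k : ℂ) • (parity left * annihilate (r k.1)) := by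
  have hp := parity_mul_self left
  refine ⟨fun k l => ?_, fun k l => ?_, fun k l => ?_⟩ <;>
  simp only [smul_mul_smul_comm,
    mul_mul_of_comm _ hp (parity_annihilate_of_right left (hr _ (Subtype.prop _))),
    mul_mul_of_comm _ hp (parity_create_of_right left (hr _ (Subtype.prop _)))]
  · rw [mul_comm (σ l : ℂ), ← smul_add, isCAR_annihilate.anti', smul_zero]
  · rw [mul_comm (σ l : ℂ), ← smul_add, isCAR_annihilate.anti, smul_zero]
  · rw [mul_comm (σ l : ℂ), ← smul_add, add_comm, isCAR_annihilate.mixed]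
    by_cases hkl : k = l
    · subst hkl
      rw [if_pos rfl, if_pos rfl, ← Complex.ofReal_mul, hσ, Complex.ofReal_one, one_smul]
    · rw [if_neg hkl, if_neg (fun h => hkl (Subtype.ext (hinj h).symm)), smul_zero]

end Parity

/-! ### The two commuting half algebras -/

section FockReflection

lemma IsCAR.commute_bilinear {M : Type*} [LinearOrder M] {B : Type*} [Ring B] {b b' : M → B}
    (h : IsCAR b b') {k l m n : M} (hkn : k ≠ n) (hlm : l ≠ m) :
    Commute (b' k * b l) (b' m * b n) := by
  have h1 : Commute (b' k * b l) (b' m) := by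
    unfold Commute SemiconjBy
    rw [mul_assoc, h.mixed_comm hlm, mul_neg, ← mul_assoc, h.anti_comm' k m, neg_mul, neg_neg,
      mul_assoc]
  have h2 : Commute (b' k * b l) (b n) := by
    unfold Commute SemiconjBy
    have := h.mixed_comm hkn.symm
    rw [mul_assoc, h.anti_comm l n, mul_neg, ← mul_assoc, ← mul_assoc, this, neg_mul]
  exact h1.mul_right h2

variable {M : Type*} [LinearOrder M] [Fintype M] (left : M → Prop) [DecidablePred left]

/-- The operators of the left modes, up to a Klein transformation. -/
def leftHom : Matrix (Finset {k // left k}) (Finset {k // left k}) ℂ →ₐ[ℂ]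
    Matrix (Finset M) (Finset M) ℂ :=
  (isCAR_left left).lift

lemma leftHom_annihilate (k : {k // left k}) :
    leftHom left (annihilate k) = Complex.I • (parity left * annihilate k.1) :=
  (isCAR_left left).lift_annihilate k

lemma leftHom_create (k : {k // left k}) :
    leftHom left (annihilate k)ᴴ = Complex.I • (parity left * (annihilate k.1)ᴴ) :=
  (isCAR_left left).lift_create k

lemma leftHom_bilinear (k l : {k // left k}) :
    leftHom left ((annihilate k)ᴴ * annihilate l) = (annihilate k.1)ᴴ * annihilate l.1 := by
  rw [map_mul, leftHom_annihilate, leftHom_create, smul_mul_smul_comm, Complex.I_mul_I,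
    mul_mul_of_anticomm _ (parity_mul_self left) (parity_create_of_left left k.2), neg_one_smul,
    neg_neg]

variable {left} {r : M → M} {σ : M → ℝ} (hr : ∀ k, left k → ¬ left (r k))
  (hinj : Function.Injective r) (hσ : ∀ k, σ k * σ k = 1)

/-- The reflection of the left modes to the right modes, combined with a particle-hole
transformation, a gauge transformation and a Klein transformation. -/
def rightHom : Matrix (Finset {k // left k}) (Finset {k // left k}) ℂ →ₐ[ℂ]
    Matrix (Finset M) (Finset M) ℂ :=
  (isCAR_right hr hinj hσ).lift

lemma rightHom_annihilate (k : {k // left k}) :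
    rightHom hr hinj hσ (annihilate k) = (σ k : ℂ) • (parity left * (annihilate (r k.1))ᴴ) :=
  (isCAR_right hr hinj hσ).lift_annihilate k

lemma rightHom_create (k : {k // left k}) :
    rightHom hr hinj hσ (annihilate k)ᴴ = (σ k : ℂ) • (parity left * annihilate (r k.1)) :=
  (isCAR_right hr hinj hσ).lift_create k

lemma rightHom_bilinear (k l : {k // left k}) :
    rightHom hr hinj hσ ((annihilate k)ᴴ * annihilate l) =
      ((σ k * σ l : ℝ) : ℂ) • ((if k = l then 1 else 0) -
        (annihilate (r l.1))ᴴ * annihilate (r k.1)) := by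
  have h1 := isCAR_annihilate.mixed (r k.1) (r l.1)
  have h2 : (if r k.1 = r l.1 then (1 : Matrix (Finset M) (Finset M) ℂ) else 0) =
      if k = l then 1 else 0 := by simp [hinj.eq_iff, Subtype.ext_iff]
  rw [h2] at h1
  rw [map_mul, rightHom_annihilate, rightHom_create, smul_mul_smul_comm,
    mul_mul_of_comm _ (parity_mul_self left) (parity_annihilate_of_right left (hr _ k.2)), ← h1,
    add_sub_cancel_right, Complex.ofReal_mul]

/-- Moving the parity past a left mode gives a sign, past a right mode none; this extra sign cancels
the fermionic one. -/
lemma commute_leftHom_rightHom (u v : Matrix (Finset {k // left k}) (Finset {k // left k}) ℂ) :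
    Commute (leftHom left u) (rightHom hr hinj hσ v) := by
  have hp := parity_mul_self left
  have hne : ∀ k l : {k // left k}, k.1 ≠ r l.1 := fun k l h => hr _ l.2 (h ▸ k.2)
  have hcar := isCAR_annihilate (M := M)
  refine (isCAR_right hr hinj hσ).commute_lift (fun l => ?_) (fun l => ?_) v <;>
  refine (Commute.symm ((isCAR_left left).commute_lift (fun k => ?_) (fun k => ?_) u)) <;>
  refine Commute.smul_right (Commute.smul_left ?_ _) _ <;>
  unfold Commute SemiconjBy
  · rw [mul_mul_of_comm _ hp (parity_create_of_right left (hr _ l.2)),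
      mul_mul_of_anticomm _ hp (parity_annihilate_of_left left k.2), hcar.mixed_comm (hne k l),
      neg_neg]
  · rw [mul_mul_of_comm _ hp (parity_create_of_right left (hr _ l.2)),
      mul_mul_of_anticomm _ hp (parity_create_of_left left k.2), hcar.anti_comm' k.1 (r l.1),
      neg_neg]
  · rw [mul_mul_of_comm _ hp (parity_annihilate_of_right left (hr _ l.2)),
      mul_mul_of_anticomm _ hp (parity_annihilate_of_left left k.2), hcar.anti_comm k.1 (r l.1),
      neg_neg]
  · rw [mul_mul_of_comm _ hp (parity_annihilate_of_right left (hr _ l.2)),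
      mul_mul_of_anticomm _ hp (parity_create_of_left left k.2),
      hcar.mixed_comm (hne k l).symm]

/-- The `I` of the left Klein factor survives, matching the imaginary hopping amplitude; with its
creation counterpart this makes up a crossing hopping term. -/
lemma leftHom_mul_rightHom_annihilate (k : {k // left k}) :
    leftHom left (annihilate k) * rightHom hr hinj hσ (annihilate k) =
      (Complex.I * σ k) • ((annihilate (r k.1))ᴴ * annihilate k.1) := by
  have hne : k.1 ≠ r k.1 := fun h => hr _ k.2 (h ▸ k.2)
  rw [leftHom_annihilate, rightHom_annihilate, smul_mul_smul_comm,
    mul_mul_of_anticomm _ (parity_mul_self left) (parity_annihilate_of_left left k.2),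
    isCAR_annihilate.mixed_comm hne, neg_neg]

lemma leftHom_mul_rightHom_create (k : {k // left k}) :
    leftHom left (annihilate k)ᴴ * rightHom hr hinj hσ (annihilate k)ᴴ =
      -((Complex.I * σ k) • ((annihilate k.1)ᴴ * annihilate (r k.1))) := by
  rw [leftHom_create, rightHom_create, smul_mul_smul_comm,
    mul_mul_of_anticomm _ (parity_mul_self left) (parity_create_of_left left k.2), smul_neg]

end FockReflection

variable {ν L : ℕ}

/-! ### Bonds -/

/-- A bond of the lattice: the bond `(x, μ)` joins `x` and `x + e_μ`. -/
abbrev Bond (ν L : ℕ) : Type := Site ν L × Fin ν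

/-- The end point of a bond. -/
def Bond.tgt (b : Bond ν L) : Site ν L := shift b.1 b.2

/-- The sign of the hopping term on a bond. -/
def Bond.hopSign (b : Bond ν L) : ℝ := (-1) ^ theta b.2 b.1

section Operators

variable {A : Type*} [Ring A] [Algebra ℂ A] (ψ ψ' : Fin 3 → Site ν L → A)

/-- The operators `S^{(a)}(x)` for given annihilation operators `ψ` and creation operators `ψ'`. -/
def genSpin (a : ℕ) (x : Site ν L) : A :=
  ∑ i : Fin 3, ∑ j : Fin 3, gellMann a i j • (ψ' i x * ψ j x)

/-- The operators `Ψ†(x) Ψ(y)` for given annihilation operators `ψ` and creation operators `ψ'`. -/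
def genHop (x y : Site ν L) : A := ∑ i : Fin 3, ψ' i x * ψ i y

/-- The contribution of a bond to the Hamiltonian with field `w`. -/
def bondTerm (κ g w : ℝ) (b : Bond ν L) : A :=
  (Complex.I * (κ * b.hopSign : ℝ)) • (genHop ψ ψ' b.1 b.tgt - genHop ψ ψ' b.tgt b.1)
  + (g : ℂ) • ∑ a ∈ Finset.Icc 1 8, genSpin ψ ψ' a b.1 * genSpin ψ ψ' a b.tgt
  + ((g * w : ℝ) : ℂ) • (genSpin ψ ψ' 3 b.1 + genSpin ψ ψ' 3 b.tgt)
  + ((g * w ^ 2 / 2 : ℝ) : ℂ) • 1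

end Operators

/-- The creation operators. -/
def psiDag (i : Fin 3) (x : Site ν L) : Op ν L := (psi i x)ᴴ

lemma genSpin_psi (a : ℕ) (x : Site ν L) : genSpin psi psiDag a x = spin a x := rfl

lemma genHop_psi (x y : Site ν L) : genHop psi psiDag x y = hop x y := rfl

/-- The staggering sign as a real number. -/
def staggerSign (x : Site ν L) : ℝ := (-1) ^ (∑ j : Fin ν, ((x j : Coord L) : ℤ))

lemma ofReal_staggerSign (x : Site ν L) : (staggerSign x : ℂ) = stagger x := by
  simp [staggerSign, stagger]

/-- The Hamiltonian whose field `w` includes the staggering sign. -/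
def bondHamiltonian (κ g m : ℝ) (w : Bond ν L → ℝ) : Op ν L :=
  ∑ b, bondTerm psi psiDag κ g (w b) b + ∑ x, ((m * staggerSign x : ℝ) : ℂ) • spin 2 x

lemma mode_ne {i j : Fin 3} {x y : Site ν L} (h : x ≠ y) : mode i x ≠ mode j y := by
  intro he
  have h1 : (i, toLex x).2 = (j, toLex y).2 := by
    have := congrArg (fun k : Lex (Lex (Site ν L) × Fin 3) => (ofLex k).1) he
    exact this
  exact h (toLex.injective h1)

lemma spin_commute (a b : ℕ) {x y : Site ν L} (h : x ≠ y) : Commute (spin a x) (spin b y) := by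
  refine Commute.sum_left _ _ _ fun i _ => Commute.sum_left _ _ _ fun j _ =>
    Commute.sum_right _ _ _ fun k _ => Commute.sum_right _ _ _ fun l _ =>
    Commute.smul_left (Commute.smul_right ?_ _) _
  exact isCAR_annihilate.commute_bilinear (mode_ne h) (mode_ne h)

lemma star_gellMann (a : ℕ) (i j : Fin 3) : star (gellMann a i j) = gellMann a j i := by
  unfold gellMann
  split <;> fin_cases i <;> fin_cases j <;> simp

lemma sum_gellMann_diag (a : ℕ) : ∑ i, gellMann a i i = 0 := by
  unfold gellMann
  split <;> simp [Fin.sum_univ_three]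
  ring

/-! ### Reflections of the lattice -/

/-- The site of a mode. -/
def Mode.site (k : Mode ν L) : Site ν L :=
  ofLex (ofLex (α := Lex (Site ν L) × Fin 3) k).1

/-- The flavour of a mode. -/
def Mode.flavour (k : Mode ν L) : Fin 3 := (ofLex (α := Lex (Site ν L) × Fin 3) k).2

/-- A reflection of the lattice, compatible with the hopping amplitudes up to a gauge
transformation. -/
structure LatticeReflection (ν L : ℕ) (κ : ℝ) where
  /-- the left half of the lattice -/
  left : Site ν L → Prop
  /-- the reflection of the sites -/
  refl : Site ν L → Site ν L
  /-- the gauge transformation -/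
  sign : Site ν L → ℝ
  /-- the reflection of the bonds -/
  bond : Bond ν L → Bond ν L
  refl_refl : ∀ x, refl (refl x) = x
  left_refl : ∀ x, left (refl x) ↔ ¬ left x
  sign_mul_self : ∀ x, sign x * sign x = 1
  stagger_refl : ∀ x, staggerSign (refl x) = -staggerSign x
  bond_bond : ∀ b : Bond ν L, bond (bond b) = b
  -- Antilinearity turns `iκ` into `-iκ`, which explains the minus sign when orientation is kept;
  -- reversing the orientation contributes a second minus.
  bond_ends : ∀ b : Bond ν L, ((bond b).1 = refl b.1 ∧ (bond b).tgt = refl b.tgt ∧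
      (left b.1 → left b.tgt → (bond b).hopSign = -(b.hopSign * (sign b.1 * sign b.tgt)))) ∨
    ((bond b).1 = refl b.tgt ∧ (bond b).tgt = refl b.1 ∧
      (left b.1 → left b.tgt → (bond b).hopSign = b.hopSign * (sign b.1 * sign b.tgt)))
  -- The sign conditions make crossing hopping terms enter the Hamiltonian as a nonpositive multiple
  -- of products of an operator with its own reflection. A bond directed from right to left has the
  -- opposite sign.
  cross_left : ∀ b : Bond ν L, left b.1 → ¬ left b.tgt → b.tgt = refl b.1 ∧ 0 ≤ κ * (b.hopSign * sign b.1)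
  cross_right : ∀ b : Bond ν L, ¬ left b.1 → left b.tgt → b.1 = refl b.tgt ∧
    0 ≤ -(κ * (b.hopSign * sign b.tgt))

namespace LatticeReflection

variable {κ : ℝ} (R : LatticeReflection ν L κ)

/-- The modes in the left half of the lattice. -/
def leftMode (k : Mode ν L) : Prop := R.left k.site

/-- The reflection of the modes. -/
def reflMode (k : Mode ν L) : Mode ν L := mode k.flavour (R.refl k.site)

lemma not_leftMode_reflMode (k : Mode ν L) (h : R.leftMode k) : ¬ R.leftMode (R.reflMode k) :=
  fun h' => (R.left_refl k.site).1 h' h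

lemma reflMode_reflMode (k : Mode ν L) : R.reflMode (R.reflMode k) = k := by
  change mode k.flavour (R.refl (R.refl k.site)) = k
  rw [R.refl_refl]
  rfl

lemma reflMode_injective : Function.Injective R.reflMode :=
  Function.LeftInverse.injective R.reflMode_reflMode

instance : DecidablePred R.left := Classical.decPred _

instance : DecidablePred R.leftMode := Classical.decPred _

/-- The left mode with flavour `i` at the left site `x`. -/
def modeL (i : Fin 3) {x : Site ν L} (h : R.left x) : {k : Mode ν L // R.leftMode k} :=
  ⟨mode i x, h⟩

/-- Operators on the Fock space of the left half of the lattice. -/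
abbrev LeftOp : Type :=
  Matrix (Finset {k : Mode ν L // R.leftMode k}) (Finset {k : Mode ν L // R.leftMode k}) ℂ

/-- The fermion operators of the left half of the lattice. -/
def psiL (i : Fin 3) (x : Site ν L) : R.LeftOp :=
  if h : R.left x then annihilate (R.modeL i h) else 0

/-- The creation operators of the left half of the lattice. -/
def psiDagL (i : Fin 3) (x : Site ν L) : R.LeftOp :=
  if h : R.left x then (annihilate (R.modeL i h))ᴴ else 0

/-- The embedding of the operators on the left half. -/
def toLeft : R.LeftOp →ₐ[ℂ] Op ν L := leftHom R.leftMode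

/-- The linear part of the reflection. -/
def toRight : R.LeftOp →ₐ[ℂ] Op ν L :=
  rightHom (σ := fun k => R.sign k.site) R.not_leftMode_reflMode R.reflMode_injective
    (fun k => R.sign_mul_self k.site)

/-- The antilinear reflection of the operators on the left half to the right half. -/
def reflOp : R.LeftOp →ₐ[ℝ] Op ν L := (R.toRight.restrictScalars ℝ).comp (conjMatrix _)

lemma commute_toLeft_toRight (u v : R.LeftOp) : Commute (R.toLeft u) (R.toRight v) :=
  commute_leftHom_rightHom _ _ _ u v

lemma toLeft_bilinear {x y : Site ν L} (hx : R.left x) (hy : R.left y) (i j : Fin 3) :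
    R.toLeft (R.psiDagL i x * R.psiL j y) = psiDag i x * psi j y := by
  rw [psiDagL, psiL, dif_pos hx, dif_pos hy]
  exact leftHom_bilinear R.leftMode _ _

lemma reflOp_smul (c : ℂ) (u : R.LeftOp) : R.reflOp (c • u) = star c • R.reflOp u := by
  change R.toRight (conjMatrix _ (c • u)) = star c • R.toRight (conjMatrix _ u)
  rw [conjMatrix_smul, map_smul]

lemma reflOp_bilinear {x y : Site ν L} (hx : R.left x) (hy : R.left y) (i j : Fin 3) :
    R.reflOp (R.psiDagL i x * R.psiL j y) =
      ((R.sign x * R.sign y : ℝ) : ℂ) •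
        ((if i = j ∧ x = y then 1 else 0) - psiDag j (R.refl y) * psi i (R.refl x)) := by
  rw [psiDagL, psiL, dif_pos hx, dif_pos hy]
  change R.toRight (conjMatrix _ _) = _
  rw [map_mul, conjMatrix_create, conjMatrix_annihilate]
  refine (rightHom_bilinear _ _ _ _ _).trans ?_
  congr 2
  refine if_congr ?_ rfl rfl
  constructor
  · intro h
    have h' : mode i x = mode j y := congrArg Subtype.val h
    exact ⟨congrArg Mode.flavour h', congrArg Mode.site h'⟩
  · rintro ⟨rfl, rfl⟩; rfl

lemma toLeft_mul_reflOp_psiL {x : Site ν L} (hx : R.left x) (i : Fin 3) :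
    R.toLeft (R.psiL i x) * R.reflOp (R.psiL i x) =
      (Complex.I * R.sign x) • (psiDag i (R.refl x) * psi i x) := by
  rw [psiL, dif_pos hx]
  change _ * R.toRight (conjMatrix _ _) = _
  rw [conjMatrix_annihilate]
  exact leftHom_mul_rightHom_annihilate _ _ _ _

lemma toLeft_mul_reflOp_psiDagL {x : Site ν L} (hx : R.left x) (i : Fin 3) :
    R.toLeft (R.psiDagL i x) * R.reflOp (R.psiDagL i x) =
      -((Complex.I * R.sign x) • (psiDag i x * psi i (R.refl x))) := by
  rw [psiDagL, dif_pos hx]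
  change _ * R.toRight (conjMatrix _ _) = _
  rw [conjMatrix_create]
  exact leftHom_mul_rightHom_create _ _ _ _

/-- The operators `S^{(a)}` of the left half. -/
def spinL (a : ℕ) (x : Site ν L) : R.LeftOp := genSpin R.psiL R.psiDagL a x

lemma toLeft_spinL (a : ℕ) {x : Site ν L} (hx : R.left x) : R.toLeft (R.spinL a x) = spin a x := by
  simp only [spinL, genSpin, map_sum, map_smul, R.toLeft_bilinear hx hx]
  rfl

lemma toLeft_hop {x y : Site ν L} (hx : R.left x) (hy : R.left y) :
    R.toLeft (genHop R.psiL R.psiDagL x y) = hop x y := by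
  simp only [genHop, map_sum, R.toLeft_bilinear hx hy]
  rfl

/-- The particle-hole transformation transposes the Gell-Mann matrix and antilinearity conjugates
it; hermiticity undoes the combination, and tracelessness removes the constant. Real and imaginary
generators are thus treated alike. -/
lemma reflOp_spinL (a : ℕ) {x : Site ν L} (hx : R.left x) :
    R.reflOp (R.spinL a x) = -spin a (R.refl x) := by
  have h1 : R.reflOp (R.spinL a x) = ∑ i, ∑ j, (gellMann a j i • (if i = j then 1 else 0) -
      gellMann a j i • (psiDag j (R.refl x) * psi i (R.refl x))) := by
    simp only [spinL, genSpin, map_sum, R.reflOp_smul, R.reflOp_bilinear hx hx, R.sign_mul_self,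
      star_gellMann, Complex.ofReal_one, one_smul, and_true, smul_sub]
  have h2 : ∑ i : Fin 3, ∑ j, gellMann a j i • (if i = j then (1 : Op ν L) else 0) = 0 := by
    simp only [smul_ite, smul_zero, Finset.sum_ite_eq, Finset.mem_univ, if_true, ← Finset.sum_smul,
      sum_gellMann_diag, zero_smul]
  rw [h1]
  simp only [Finset.sum_sub_distrib]
  rw [h2, zero_sub, Finset.sum_comm]
  rfl

lemma reflOp_hop {x y : Site ν L} (hx : R.left x) (hy : R.left y) :
    R.reflOp (genHop R.psiL R.psiDagL x y - genHop R.psiL R.psiDagL y x) =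
      ((R.sign x * R.sign y : ℝ) : ℂ) •
        (hop (R.refl x) (R.refl y) - hop (R.refl y) (R.refl x)) := by
  simp only [genHop, map_sub, map_sum, R.reflOp_bilinear hx hy, R.reflOp_bilinear hy hx,
    true_and, ← Finset.smul_sum, mul_comm (R.sign y), ← smul_sub, Finset.sum_sub_distrib,
    eq_comm (a := y)]
  congr 1
  rw [sub_sub_sub_cancel_left]
  rfl

lemma toLeft_bondTerm (g w : ℝ) {b : Bond ν L} (h : R.left b.1) (h' : R.left b.tgt) :
    R.toLeft (bondTerm R.psiL R.psiDagL κ g w b) = bondTerm psi psiDag κ g w b := by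
  have hs := fun a => R.toLeft_spinL a h
  have hs' := fun a => R.toLeft_spinL a h'
  simp only [spinL] at hs hs'
  simp only [bondTerm, map_add, map_sub, map_smul, map_one, map_sum, map_mul, hs, hs',
    R.toLeft_hop h h', R.toLeft_hop h' h, genSpin_psi, genHop_psi]

/-- Products of two spins are unchanged, while terms linear in `S^(3)` change sign, hence `-w`. The
hopping sign is the content of `bond_ends`. -/
lemma reflOp_bondTerm (g w : ℝ) {b : Bond ν L} (h : R.left b.1) (h' : R.left b.tgt) :
    R.reflOp (bondTerm R.psiL R.psiDagL κ g w b) = bondTerm psi psiDag κ g (-w) (R.bond b) := by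
  have hs := fun a => R.reflOp_spinL a h
  have hs' := fun a => R.reflOp_spinL a h'
  simp only [spinL] at hs hs'
  have hcomm : ∀ a, spin a (R.refl b.1) * spin a (R.refl b.tgt) =
      spin a (R.refl b.tgt) * spin a (R.refl b.1) := by
    intro a
    by_cases hxy : R.refl b.1 = R.refl b.tgt
    · rw [hxy]
    · exact (spin_commute a a hxy).eq
  have e : R.reflOp (bondTerm R.psiL R.psiDagL κ g w b) =
      (Complex.I * ((-(κ * (b.hopSign * (R.sign b.1 * R.sign b.tgt))) : ℝ) : ℂ)) •
        (hop (R.refl b.1) (R.refl b.tgt) - hop (R.refl b.tgt) (R.refl b.1))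
      + (g : ℂ) • ∑ a ∈ Finset.Icc 1 8, spin a (R.refl b.1) * spin a (R.refl b.tgt)
      + ((g * -w : ℝ) : ℂ) • (spin 3 (R.refl b.1) + spin 3 (R.refl b.tgt))
      + ((g * (-w) ^ 2 / 2 : ℝ) : ℂ) • 1 := by
    simp only [bondTerm, map_add, R.reflOp_smul, map_one, map_sum, map_mul, hs, hs',
      R.reflOp_hop h h', neg_mul_neg, smul_smul]
    simp only [star_mul, Complex.star_def, Complex.conj_I, Complex.conj_ofReal]
    push_cast
    module
  rw [e]
  rcases R.bond_ends b with ⟨h1, h2, h3⟩ | ⟨h1, h2, h3⟩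
  · simp only [bondTerm, genSpin_psi, genHop_psi, h1, h2, h3 h h']
    congr 4
    push_cast; ring
  · simp only [bondTerm, genSpin_psi, genHop_psi, h1, h2, h3 h h', hcomm]
    push_cast
    module

end LatticeReflection

/-! ### Splitting the Hamiltonian along a reflection plane -/

namespace LatticeReflection

variable {κ : ℝ} (R : LatticeReflection ν L κ)

/-- The field which is `p` on the left half, the reflection of `q` on the right half, and `p - q`
on the bonds crossing the reflection plane. -/
def glue (p q : Bond ν L → ℝ) (b : Bond ν L) : ℝ :=
  if R.left b.1 then if R.left b.tgt then p b else p b - q b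
  else if R.left b.tgt then p b - q b else -q (R.bond b)

/-- The part of the field terms on a crossing bond assigned to its left end point. -/
def endTerm (g p : ℝ) (x : Site ν L) : R.LeftOp :=
  ((g * p : ℝ) : ℂ) • R.spinL 3 x + ((g * p ^ 2 / 2 : ℝ) : ℂ) • 1

/-- The part of a bond contribution assigned to the left half. -/
def leftBond (g p : ℝ) (b : Bond ν L) : R.LeftOp :=
  if R.left b.1 then
    if R.left b.tgt then bondTerm R.psiL R.psiDagL κ g p b else R.endTerm g p b.1
  else if R.left b.tgt then R.endTerm g p b.tgt else 0

/-- The part of the Hamiltonian assigned to the left half. -/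
def leftHamiltonian (g m : ℝ) (p : Bond ν L → ℝ) : R.LeftOp :=
  ∑ b, R.leftBond g (p b) b +
    ∑ x, if R.left x then ((m * staggerSign x : ℝ) : ℂ) • R.spinL 2 x else 0

/-- The operators `S^{(a)}(x)`, with `S^{(3)}(x)` shifted by `p`. -/
def shiftedSpin (a : ℕ) (p : ℝ) (x : Site ν L) : R.LeftOp :=
  R.spinL a x + if a = 3 then (p : ℂ) • 1 else 0

/-- The coupling of a site on the left to its mirror image. -/
def crossTerm (g w p q : ℝ) (x : Site ν L) : Op ν L :=
  (g : ℂ) • ∑ a ∈ Finset.Icc 1 8,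
      R.toLeft (R.shiftedSpin a p x) * R.reflOp (R.shiftedSpin a q x)
  + (w : ℂ) • ∑ i, (R.toLeft (R.psiL i x) * R.reflOp (R.psiL i x) +
      R.toLeft (R.psiDagL i x) * R.reflOp (R.psiDagL i x))

/-- The coupling of the two halves on a crossing bond. -/
def crossBond (g p q : ℝ) (b : Bond ν L) : Op ν L :=
  if R.left b.1 then
    if R.left b.tgt then 0 else R.crossTerm g (κ * (b.hopSign * R.sign b.1)) p q b.1
  else if R.left b.tgt then R.crossTerm g (-(κ * (b.hopSign * R.sign b.tgt))) p q b.tgt else 0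

lemma sum_shiftedSpin (p q : ℝ) {x : Site ν L} (hx : R.left x) :
    ∑ a ∈ Finset.Icc 1 8, R.toLeft (R.shiftedSpin a p x) * R.reflOp (R.shiftedSpin a q x) =
      -∑ a ∈ Finset.Icc 1 8, spin a x * spin a (R.refl x)
      + ((q : ℂ) • spin 3 x - (p : ℂ) • spin 3 (R.refl x) + ((p * q : ℝ) : ℂ) • 1) := by
  have h : ∀ a ∈ Finset.Icc 1 8,
      R.toLeft (R.shiftedSpin a p x) * R.reflOp (R.shiftedSpin a q x) =
      -(spin a x * spin a (R.refl x)) + if a = 3 then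
        (q : ℂ) • spin 3 x - (p : ℂ) • spin 3 (R.refl x) + ((p * q : ℝ) : ℂ) • 1 else 0 := by
    intro a _
    simp only [shiftedSpin, map_add, R.toLeft_spinL a hx, R.reflOp_spinL a hx]
    split_ifs with ha
    · subst ha
      simp only [map_smul, R.reflOp_smul, map_one, Complex.star_def, Complex.conj_ofReal, mul_add,
        add_mul, mul_neg, smul_mul_assoc, mul_smul_comm, one_mul, mul_one]
      push_cast
      module
    · simp
  rw [Finset.sum_congr rfl h, Finset.sum_add_distrib, Finset.sum_neg_distrib,
    Finset.sum_ite_eq' _ 3, if_pos (by decide)]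

lemma sum_psiL {x : Site ν L} (hx : R.left x) :
    ∑ i, (R.toLeft (R.psiL i x) * R.reflOp (R.psiL i x) +
      R.toLeft (R.psiDagL i x) * R.reflOp (R.psiDagL i x)) =
    (Complex.I * R.sign x) • (hop (R.refl x) x - hop x (R.refl x)) := by
  simp only [R.toLeft_mul_reflOp_psiL hx, R.toLeft_mul_reflOp_psiDagL hx, ← sub_eq_add_neg,
    ← smul_sub, ← Finset.smul_sum, Finset.sum_sub_distrib]
  rfl

lemma toLeft_endTerm (g p : ℝ) {x : Site ν L} (hx : R.left x) :
    R.toLeft (R.endTerm g p x) =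
      ((g * p : ℝ) : ℂ) • spin 3 x + ((g * p ^ 2 / 2 : ℝ) : ℂ) • 1 := by
  simp only [endTerm, map_add, map_smul, map_one, R.toLeft_spinL 3 hx]

lemma reflOp_endTerm (g p : ℝ) {x : Site ν L} (hx : R.left x) :
    R.reflOp (R.endTerm g p x) =
      -(((g * p : ℝ) : ℂ) • spin 3 (R.refl x)) + ((g * p ^ 2 / 2 : ℝ) : ℂ) • 1 := by
  simp only [endTerm, map_add, R.reflOp_smul, map_one, R.reflOp_spinL 3 hx, Complex.star_def,
    Complex.conj_ofReal, smul_neg]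

/-- Since the reflection of `S + q` is `-S' + q`, the product `-(S + p)(-S' + q)` together with the
end terms depends on `p` and `q` only through `p - q`, as in completing a square. -/
lemma endTerm_sub_crossTerm (g w p q : ℝ) {x : Site ν L} (hx : R.left x) :
    R.toLeft (R.endTerm g p x) + R.reflOp (R.endTerm g q x) - R.crossTerm g w p q x =
      (Complex.I * (w * R.sign x : ℝ)) • (hop x (R.refl x) - hop (R.refl x) x)
      + (g : ℂ) • ∑ a ∈ Finset.Icc 1 8, spin a x * spin a (R.refl x)
      + ((g * (p - q) : ℝ) : ℂ) • (spin 3 x + spin 3 (R.refl x))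
      + ((g * (p - q) ^ 2 / 2 : ℝ) : ℂ) • 1 := by
  rw [R.toLeft_endTerm _ _ hx, R.reflOp_endTerm _ _ hx, crossTerm, R.sum_shiftedSpin p q hx,
    R.sum_psiL hx]
  push_cast
  module

lemma bondTerm_cross_left (g p q : ℝ) {b : Bond ν L} (h : R.left b.1) (h' : ¬ R.left b.tgt) :
    bondTerm psi psiDag κ g (p - q) b =
      R.toLeft (R.leftBond g p b) + R.reflOp (R.leftBond g q b) - R.crossBond g p q b := by
  simp only [leftBond, crossBond, if_pos h, if_neg h']
  rw [R.endTerm_sub_crossTerm _ _ _ _ h]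
  simp only [bondTerm, genSpin_psi, genHop_psi, (R.cross_left b h h').1]
  rw [mul_assoc κ, mul_assoc b.hopSign, R.sign_mul_self, mul_one]

lemma bondTerm_cross_right (g p q : ℝ) {b : Bond ν L} (h : ¬ R.left b.1) (h' : R.left b.tgt) :
    bondTerm psi psiDag κ g (p - q) b =
      R.toLeft (R.leftBond g p b) + R.reflOp (R.leftBond g q b) - R.crossBond g p q b := by
  have hne : b.tgt ≠ R.refl b.tgt := fun he => (R.left_refl b.tgt).1 (he ▸ h') h'
  simp only [leftBond, crossBond, if_neg h, if_pos h']
  rw [R.endTerm_sub_crossTerm _ _ _ _ h']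
  simp only [bondTerm, genSpin_psi, genHop_psi, (R.cross_right b h h').1,
    (spin_commute _ _ hne).eq]
  rw [neg_mul, mul_assoc κ, mul_assoc b.hopSign, R.sign_mul_self, mul_one]
  push_cast
  module

lemma left_bond_iff (b : Bond ν L) : (R.left (R.bond b).1 ∧ R.left (R.bond b).tgt) ↔
    (¬ R.left b.1 ∧ ¬ R.left b.tgt) := by
  rcases R.bond_ends b with ⟨h1, h2, -⟩ | ⟨h1, h2, -⟩
  · rw [h1, h2, R.left_refl, R.left_refl]
  · rw [h1, h2, R.left_refl, R.left_refl, and_comm]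

/-- The reflection of the bonds as a permutation. -/
def bondPerm : Equiv.Perm (Bond ν L) := Function.Involutive.toPerm R.bond R.bond_bond

/-- The reflection of the sites as a permutation. -/
def reflPerm : Equiv.Perm (Site ν L) := Function.Involutive.toPerm R.refl R.refl_refl

lemma sum_bondTerm_glue (g : ℝ) (p q : Bond ν L → ℝ) :
    ∑ b, bondTerm psi psiDag κ g (R.glue p q b) b =
      ∑ b, (R.toLeft (R.leftBond g (p b) b) + R.reflOp (R.leftBond g (q b) b)
        - R.crossBond g (p b) (q b) b) := by
  -- The reflection of a left bond `b` contributes at `R.bond b`, not at `b`. Bond by bond the two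
  -- sides differ by `f (R.bond b) - f b`, which sums to zero.
  let f : Bond ν L → Op ν L := fun b =>
    if R.left b.1 ∧ R.left b.tgt then bondTerm psi psiDag κ g (-q b) (R.bond b) else 0
  have h : ∀ b, bondTerm psi psiDag κ g (R.glue p q b) b =
      (R.toLeft (R.leftBond g (p b) b) + R.reflOp (R.leftBond g (q b) b)
        - R.crossBond g (p b) (q b) b) + (f (R.bond b) - f b) := by
    intro b
    simp only [f, R.left_bond_iff, R.bond_bond, glue]
    by_cases h1 : R.left b.1 <;> by_cases h2 : R.left b.tgt
    · simp [h1, h2, leftBond, crossBond, R.toLeft_bondTerm g _ h1 h2,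
        R.reflOp_bondTerm g _ h1 h2]
    · simp [h1, h2, R.bondTerm_cross_left g _ _ h1 h2]
    · simp [h1, h2, R.bondTerm_cross_right g _ _ h1 h2]
    · simp [h1, h2, leftBond, crossBond]
  have hf : ∑ b, (f (R.bond b) - f b) = 0 := by
    rw [Finset.sum_sub_distrib, sub_eq_zero]
    exact Equiv.sum_comp R.bondPerm f
  rw [Finset.sum_congr rfl fun b _ => h b, Finset.sum_add_distrib, hf, add_zero]

lemma sum_order (m : ℝ) :
    ∑ x, ((m * staggerSign x : ℝ) : ℂ) • spin 2 x =
      R.toLeft (∑ x, if R.left x then ((m * staggerSign x : ℝ) : ℂ) • R.spinL 2 x else 0) +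
      R.reflOp (∑ x, if R.left x then ((m * staggerSign x : ℝ) : ℂ) • R.spinL 2 x else 0) := by
  let f : Site ν L → Op ν L := fun x =>
    if R.left x then ((m * staggerSign (R.refl x) : ℝ) : ℂ) • spin 2 (R.refl x) else 0
  have hf : ∑ x, f (R.refl x) = ∑ x, f x := Equiv.sum_comp R.reflPerm f
  have h1 : R.reflOp (∑ x, if R.left x then ((m * staggerSign x : ℝ) : ℂ) • R.spinL 2 x else 0) =
      ∑ x, f x := by
    rw [map_sum]
    refine Finset.sum_congr rfl fun x _ => ?_
    by_cases hx : R.left x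
    · simp only [f, if_pos hx, R.reflOp_smul, R.reflOp_spinL 2 hx, R.stagger_refl,
        Complex.star_def, Complex.conj_ofReal]
      push_cast
      module
    · simp [f, hx]
  rw [h1, ← hf, map_sum, ← Finset.sum_add_distrib]
  refine Finset.sum_congr rfl fun x _ => ?_
  by_cases hx : R.left x
  · simp [f, R.left_refl, hx, R.toLeft_spinL 2 hx]
  · simp [f, R.left_refl, hx, R.refl_refl]

lemma bondHamiltonian_glue (g m : ℝ) (p q : Bond ν L → ℝ) :
    bondHamiltonian κ g m (R.glue p q) =
      R.toLeft (R.leftHamiltonian g m p) + R.reflOp (R.leftHamiltonian g m q)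
        - ∑ b, R.crossBond g (p b) (q b) b := by
  rw [bondHamiltonian, R.sum_bondTerm_glue, R.sum_order, leftHamiltonian, leftHamiltonian, map_add,
    map_add, Finset.sum_sub_distrib, Finset.sum_add_distrib, ← map_sum, ← map_sum]
  abel

/-- Repulsion `0 ≤ g` and the gauge condition `0 ≤ w` give the coefficients the sign that reflection
positivity requires. -/
lemma reflectionTriple_crossTerm {g w : ℝ} (hg : 0 ≤ g) (hw : 0 ≤ w) (p q : ℝ) (x : Site ν L) :
    ReflectionTriple (R.toLeft.restrictScalars ℝ) R.reflOp (R.crossTerm g w p q x)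
      (R.crossTerm g w p p x) (R.crossTerm g w q q x) := by
  simp only [crossTerm, Complex.coe_smul]
  exact ((ReflectionTriple.sum _ fun a _ => ReflectionTriple.of_mul _ _).smul hg).add
    ((ReflectionTriple.sum _ fun i _ =>
      (ReflectionTriple.of_mul _ _).add (ReflectionTriple.of_mul _ _)).smul hw)

lemma reflectionTriple_crossBond {g : ℝ} (hg : 0 ≤ g) (p q : ℝ) (b : Bond ν L) :
    ReflectionTriple (R.toLeft.restrictScalars ℝ) R.reflOp (R.crossBond g p q b)
      (R.crossBond g p p b) (R.crossBond g q q b) := by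
  unfold crossBond
  split_ifs with h1 h2 h2
  · exact ReflectionTriple.zero
  · exact R.reflectionTriple_crossTerm hg (R.cross_left b h1 h2).2 _ _ _
  · exact R.reflectionTriple_crossTerm hg (R.cross_right b h1 h2).2 _ _ _
  · exact ReflectionTriple.zero

/-- Reflection positivity bounds the partition function by those of the reflected fields. -/
theorem norm_trace_exp_glue_sq_le {g β : ℝ} (hg : 0 ≤ g) (hβ : 0 ≤ β) (m : ℝ)
    (p q : Bond ν L → ℝ) :
    ‖(NormedSpace.exp (-(β : ℂ) • bondHamiltonian κ g m (R.glue p q))).trace‖ ^ 2 ≤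
      ‖(NormedSpace.exp (-(β : ℂ) • bondHamiltonian κ g m (R.glue p p))).trace‖ *
      ‖(NormedSpace.exp (-(β : ℂ) • bondHamiltonian κ g m (R.glue q q))).trace‖ := by
  have h : ∀ p q : Bond ν L → ℝ, -(β : ℂ) • bondHamiltonian κ g m (R.glue p q) =
      R.toLeft (-(β : ℂ) • R.leftHamiltonian g m p) +
        R.reflOp (-(β : ℂ) • R.leftHamiltonian g m q) + β • ∑ b, R.crossBond g (p b) (q b) b := by
    intro p q
    rw [R.bondHamiltonian_glue, map_smul, R.reflOp_smul, ← Complex.coe_smul, star_neg,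
      Complex.star_def, Complex.conj_ofReal]
    module
  rw [h, h, h]
  exact norm_trace_exp_sq_le R.toLeft R.toRight R.commute_toLeft_toRight
    ((ReflectionTriple.sum Finset.univ fun b _ =>
      R.reflectionTriple_crossBond hg (p b) (q b) b).smul hβ) _ _

end LatticeReflection

/-! ### Reflections in the hyperplanes bisecting bonds -/

lemma Coord.coe_next (t : Coord L) : (t.next : ℤ) = if (t : ℤ) = L then -(L : ℤ) + 1 else t + 1 := by
  unfold Coord.next
  split_ifs <;> rfl

/-- The reflection of a coordinate that exchanges `c` and `c + 1`. -/
def Coord.refl {c : ℤ} (h0 : 0 ≤ c) (hL : c < L) (t : Coord L) : Coord L :=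
  if h : 2 * c + 1 - t ≤ L then ⟨2 * c + 1 - t, by have := t.2.2; omega, h⟩
  else ⟨2 * c + 1 - t - 2 * L, by omega, by have := t.2.1; omega⟩

lemma Coord.coe_refl {c : ℤ} (h0 : 0 ≤ c) (hL : c < L) (t : Coord L) :
    (t.refl h0 hL : ℤ) = if 2 * c + 1 - t ≤ L then 2 * c + 1 - t else 2 * c + 1 - t - 2 * L := by
  unfold Coord.refl
  split_ifs <;> rfl

lemma Coord.refl_refl {c : ℤ} (h0 : 0 ≤ c) (hL : c < L) (t : Coord L) :
    (t.refl h0 hL).refl h0 hL = t := by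
  have h1 := t.2.1
  have h2 := t.2.2
  apply Subtype.ext
  rw [Coord.coe_refl, Coord.coe_refl]
  split_ifs <;> omega

lemma Coord.next_refl_next {c : ℤ} (h0 : 0 ≤ c) (hL : c < L) (t : Coord L) :
    (t.next.refl h0 hL).next = t.refl h0 hL := by
  have h1 := t.2.1
  have h2 := t.2.2
  apply Subtype.ext
  rw [Coord.coe_next, Coord.coe_refl, Coord.coe_refl, Coord.coe_next]
  split_ifs <;> omega

lemma neg_one_zpow_add_odd (a : ℤ) {b : ℤ} (hb : Odd b) : (-1 : ℝ) ^ (a + b) = -(-1) ^ a := by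
  rw [zpow_add₀ (by norm_num), hb.neg_one_zpow, mul_neg_one]

lemma neg_one_zpow_mul_self (a : ℤ) : (-1 : ℝ) ^ a * (-1) ^ a = 1 := by
  rw [← mul_zpow]; simp

lemma sum_update_coord (s : Finset (Fin ν)) (x : Site ν L) (μ : Fin ν) (v : Coord L) :
    ∑ j ∈ s, ((Function.update x μ v j : Coord L) : ℤ) =
      ∑ j ∈ s, ((x j : Coord L) : ℤ) + if μ ∈ s then (v : ℤ) - x μ else 0 := by
  have h : ∀ j, ((Function.update x μ v j : Coord L) : ℤ) =
      x j + if j = μ then (v : ℤ) - x μ else 0 := by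
    intro j
    by_cases hj : j = μ
    · subst hj; simp
    · simp [hj]
  simp only [h, Finset.sum_add_distrib, Finset.sum_ite_eq']

/-- Wrapping around subtracts the even number `2L`, so the parity change survives periodicity. -/
lemma Coord.odd_refl_sub {c : ℤ} (h0 : 0 ≤ c) (hL : c < L) (t : Coord L) :
    Odd ((t.refl h0 hL : ℤ) - t) := by
  rw [Coord.coe_refl]
  split_ifs
  · exact ⟨c - t, by ring⟩
  · exact ⟨c - t - L, by ring⟩

lemma Coord.odd_next_sub (t : Coord L) : Odd ((t.next : ℤ) - t) := by
  rw [Coord.coe_next]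
  split_ifs with h
  · exact ⟨-L, by rw [h]; ring⟩
  · exact ⟨0, by ring⟩

section Plane

variable (μ : Fin ν) {c : ℤ} (h0 : 0 ≤ c) (hL : c < L) (κ : ℝ)

/-- The reflection of the sites in the hyperplane `x^{(μ)} = c + 1/2`. -/
def siteRefl (x : Site ν L) : Site ν L := Function.update x μ ((x μ).refl h0 hL)

lemma siteRefl_siteRefl (x : Site ν L) : siteRefl μ h0 hL (siteRefl μ h0 hL x) = x := by
  simp [siteRefl, Coord.refl_refl]

lemma shift_siteRefl_shift (x : Site ν L) :
    shift (siteRefl μ h0 hL (shift x μ)) μ = siteRefl μ h0 hL x := by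
  simp [siteRefl, shift, Coord.next_refl_next]

lemma shift_siteRefl {ρ : Fin ν} (h : ρ ≠ μ) (x : Site ν L) :
    shift (siteRefl μ h0 hL x) ρ = siteRefl μ h0 hL (shift x ρ) := by
  unfold siteRefl shift
  rw [Function.update_of_ne h, Function.update_of_ne h.symm, Function.update_comm h]

/-- The gauge transformation that accompanies the reflection. -/
def planeSign (c : ℤ) (x : Site ν L) : ℝ :=
  (if 0 ≤ κ then 1 else -1) * ((-1) ^ (∑ j ∈ Finset.univ.filter (· < μ), ((x j : Coord L) : ℤ)) *
    if 2 * c + 1 - x μ ≤ L then 1 else -1)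

lemma planeSign_mul_self (x : Site ν L) : planeSign μ κ c x * planeSign μ κ c x = 1 := by
  have h := neg_one_zpow_mul_self (∑ j ∈ Finset.univ.filter (· < μ), ((x j : Coord L) : ℤ))
  unfold planeSign
  split_ifs <;> linear_combination h

/-- The reflection of the bonds. -/
def bondRefl (b : Bond ν L) : Bond ν L :=
  if b.2 = μ then (siteRefl μ h0 hL b.tgt, b.2) else (siteRefl μ h0 hL b.1, b.2)

lemma bondRefl_bondRefl (b : Bond ν L) : bondRefl μ h0 hL (bondRefl μ h0 hL b) = b := by
  obtain ⟨x, ρ⟩ := b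
  unfold bondRefl Bond.tgt
  by_cases h : ρ = μ
  · subst h
    simp [shift_siteRefl_shift, siteRefl_siteRefl]
  · simp [h, siteRefl_siteRefl]

/-- The last factor of `planeSign` jumps between `x` and `x + e_μ` exactly when the reflected bond
starts at coordinate `L`, where `theta` has its extra sign. -/
lemma hopSign_refl_parallel (x : Site ν L) (h1 : c - L + 1 ≤ (x μ : ℤ))
    (h2 : (x μ : ℤ) ≤ c) :
    Bond.hopSign (siteRefl μ h0 hL (shift x μ), μ) =
      Bond.hopSign (x, μ) * (planeSign μ κ c x * planeSign μ κ c (shift x μ)) := by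
  have h := neg_one_zpow_mul_self (∑ j ∈ Finset.univ.filter (· < μ), ((x j : Coord L) : ℤ))
  have hk : ((if 0 ≤ κ then 1 else -1) * if 0 ≤ κ then 1 else -1 : ℝ) = 1 := by
    split_ifs <;> norm_num
  have hx : (x μ : ℤ) ≠ L := by omega
  simp only [Bond.hopSign, theta, planeSign, siteRefl, shift, sum_update_coord, Finset.mem_filter,
    lt_irrefl, and_false, if_false, add_zero, Function.update_self, Coord.coe_refl,
    Coord.coe_next, hx]
  set s := ∑ j ∈ Finset.univ.filter (· < μ), ((x j : Coord L) : ℤ)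
  set k : ℝ := if 0 ≤ κ then 1 else -1
  set e : ℝ := (-1) ^ s
  have hgoal : ∀ u v w : ℝ, u = v * w → e * u = e * (k * (e * v) * (k * (e * w))) := by
    intro u v w huv
    rw [huv]
    linear_combination (-e * v * w) * h * k * k - (e * v * w) * hk
  have hu : (-1 : ℝ) ^ (s + if (if 2 * c + 1 - ((x μ : ℤ) + 1) ≤ L then 2 * c + 1 - ((x μ : ℤ) + 1)
      else 2 * c + 1 - ((x μ : ℤ) + 1) - 2 * L) = L then 1 else 0) =
      e * (if 2 * c - (x μ : ℤ) = L then -1 else 1) := by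
    by_cases hc : 2 * c - (x μ : ℤ) = L
    · rw [if_pos hc, if_pos (by split_ifs <;> omega), neg_one_zpow_add_odd _ odd_one]
      ring
    · rw [if_neg hc, if_neg (by split_ifs <;> omega)]
      simp [e]
  rw [hu]
  apply hgoal
  split_ifs <;> first | omega | norm_num

/-- For `ρ < μ` the hopping sign is unaffected and the gauge changes along the bond; for `ρ > μ` the
exponent contains `x^{(μ)}`, whose parity flips, and the gauge is constant. -/
lemma hopSign_refl_transverse {ρ : Fin ν} (h : ρ ≠ μ) (x : Site ν L) :
    Bond.hopSign (siteRefl μ h0 hL x, ρ) =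
      -(Bond.hopSign (x, ρ) * (planeSign μ κ c x * planeSign μ κ c (shift x ρ))) := by
  have hsq := planeSign_mul_self μ (c := c) κ x
  rcases lt_or_gt_of_ne h with hlt | hlt
  · have e1 : Bond.hopSign (siteRefl μ h0 hL x, ρ) = Bond.hopSign (x, ρ) := by
      simp [Bond.hopSign, theta, siteRefl, sum_update_coord, hlt.not_gt, h]
    have e2 : planeSign μ κ c (shift x ρ) = -planeSign μ κ c x := by
      simp only [planeSign, shift, sum_update_coord, Finset.mem_filter, Finset.mem_univ, true_and,
        hlt, if_true, neg_one_zpow_add_odd _ (Coord.odd_next_sub (x ρ)),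
        Function.update_of_ne h.symm]
      ring
    rw [e1, e2]
    linear_combination (-Bond.hopSign (x, ρ)) * hsq
  · have e1 : Bond.hopSign (siteRefl μ h0 hL x, ρ) = -Bond.hopSign (x, ρ) := by
      simp only [Bond.hopSign, theta, siteRefl, sum_update_coord, Finset.mem_filter,
        Finset.mem_univ, true_and, hlt, if_true, Function.update_of_ne h]
      rw [add_right_comm, neg_one_zpow_add_odd _ (Coord.odd_refl_sub h0 hL (x μ))]
    have e2 : planeSign μ κ c (shift x ρ) = planeSign μ κ c x := by
      simp [planeSign, shift, sum_update_coord, hlt.not_gt, Function.update_of_ne h.symm]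
    rw [e1, e2, hsq, mul_one]

lemma mul_sign_nonneg : 0 ≤ κ * if 0 ≤ κ then 1 else -1 := by
  split_ifs with h
  · simpa using h
  · push Not at h
    linarith

/-- The reflection in the hyperplane `x^{(μ)} = c + 1/2`. -/
def planeReflection : LatticeReflection ν L κ where
  left x := c - L + 1 ≤ (x μ : ℤ) ∧ (x μ : ℤ) ≤ c
  refl := siteRefl μ h0 hL
  sign := planeSign μ κ c
  bond := bondRefl μ h0 hL
  refl_refl := siteRefl_siteRefl μ h0 hL
  left_refl x := by
    have h1 := (x μ).2.1
    have h2 := (x μ).2.2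
    simp only [siteRefl, Function.update_self, Coord.coe_refl]
    split_ifs <;> omega
  sign_mul_self := planeSign_mul_self μ κ
  stagger_refl x := by
    simp only [staggerSign, siteRefl, sum_update_coord, Finset.mem_univ, if_true,
      neg_one_zpow_add_odd _ (Coord.odd_refl_sub h0 hL (x μ))]
  bond_bond := bondRefl_bondRefl μ h0 hL
  bond_ends b := by
    obtain ⟨x, ρ⟩ := b
    by_cases h : ρ = μ
    · subst h
      right
      simp only [bondRefl, if_true, Bond.tgt]
      exact ⟨trivial, shift_siteRefl_shift ρ h0 hL x,
        fun h1 _ => hopSign_refl_parallel ρ h0 hL κ x h1.1 h1.2⟩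
    · left
      simp only [bondRefl, if_neg h, Bond.tgt]
      exact ⟨trivial, shift_siteRefl μ h0 hL h x, fun _ _ => hopSign_refl_transverse μ h0 hL κ h x⟩
  cross_left b h1 h2 := by
    obtain ⟨x, ρ⟩ := b
    have hρ : ρ = μ := by
      by_contra h
      rw [Bond.tgt, shift, Function.update_of_ne (Ne.symm h)] at h2
      exact h2 h1
    subst hρ
    have hxL : (x ρ : ℤ) ≠ L := by have := h1.2; simp only at this; omega
    simp only [Bond.tgt, shift, Function.update_self, Coord.coe_next, if_neg hxL] at h1 h2
    have hc : (x ρ : ℤ) = c := by omega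
    constructor
    · simp only [Bond.tgt, shift, siteRefl]
      congr 1
      apply Subtype.ext
      rw [Coord.coe_next, Coord.coe_refl, if_neg hxL, hc, if_pos (by omega)]
      ring
    · have h := neg_one_zpow_mul_self (∑ j ∈ Finset.univ.filter (· < ρ), ((x j : Coord L) : ℤ))
      have hk := mul_sign_nonneg κ
      have hle : 2 * c + 1 - (x ρ : ℤ) ≤ L := by omega
      simp only [Bond.hopSign, theta, planeSign, if_neg hxL, add_zero, if_pos hle]
      set s := ∑ j ∈ Finset.univ.filter (· < ρ), ((x j : Coord L) : ℤ)
      set k : ℝ := if 0 ≤ κ then 1 else -1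
      refine hk.trans (le_of_eq ?_)
      linear_combination (-κ * k) * h
  cross_right b h1 h2 := by
    obtain ⟨x, ρ⟩ := b
    have hρ : ρ = μ := by
      by_contra h
      rw [Bond.tgt, shift, Function.update_of_ne (Ne.symm h)] at h2
      exact h1 h2
    subst hρ
    have hx1 := (x ρ).2.1
    have hx2 := (x ρ).2.2
    simp only [Bond.tgt, shift, Function.update_self, Coord.coe_next] at h1 h2
    -- A bond entering the left half lies on the antipodal plane `c - L + 1/2`; for `c = 0` its
    -- starting coordinate `-L` is identified with `L`.
    have hc : (x ρ : ℤ) = if c = 0 then (L : ℤ) else c - L := by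
      split_ifs at h2 ⊢ <;> omega
    have hn : ((x ρ).next : ℤ) = c - L + 1 := by
      rw [Coord.coe_next, hc]
      split_ifs <;> omega
    constructor
    · simp only [Bond.tgt, shift, siteRefl, Function.update_self, Function.update_idem]
      conv_lhs => rw [← Function.update_eq_self ρ x]
      congr 1
      apply Subtype.ext
      rw [Coord.coe_refl, hn, hc]
      split_ifs <;> omega
    · have h := neg_one_zpow_mul_self (∑ j ∈ Finset.univ.filter (· < ρ), ((x j : Coord L) : ℤ))
      have hk := mul_sign_nonneg κ
      simp only [Bond.tgt, Bond.hopSign, theta, planeSign, shift, Function.update_self, hn,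
        sum_update_coord, Finset.mem_filter, lt_irrefl, and_false, if_false, add_zero]
      set s := ∑ j ∈ Finset.univ.filter (· < ρ), ((x j : Coord L) : ℤ)
      set k : ℝ := if 0 ≤ κ then 1 else -1
      -- Exactly one minus sign arises: from the boundary sign in `theta` if `c = 0`, from the
      -- wrap-around factor of `planeSign` otherwise.
      by_cases hc0 : c = 0
      · rw [if_pos hc0] at hc
        rw [if_pos hc, if_pos (by omega), neg_one_zpow_add_odd _ odd_one]
        refine hk.trans (le_of_eq ?_)
        linear_combination (-κ * k) * h
      · rw [if_neg hc0] at hc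
        rw [if_neg (by omega), if_neg (by omega), add_zero]
        refine hk.trans (le_of_eq ?_)
        linear_combination (-κ * k) * h

end Plane

/-- Every bond crosses some reflection plane. -/
lemma exists_reflection_crossing (κ : ℝ) (b : Bond ν L) :
    ∃ R : LatticeReflection ν L κ, ¬ (R.left b.1 ↔ R.left b.tgt) := by
  obtain ⟨x, μ⟩ := b
  have h1 := (x μ).2.1
  have h2 := (x μ).2.2
  -- Only `0 ≤ c < L` is available, so the bond is placed on the plane `c + 1/2` when `0 ≤ x^{(μ)} <
  -- L`, and on the antipodal plane otherwise.
  let c : ℤ := if (x μ : ℤ) = L then 0 else if 0 ≤ (x μ : ℤ) then x μ else x μ + L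
  have h0 : 0 ≤ c := by simp only [c]; split_ifs <;> omega
  have hL : c < L := by simp only [c]; split_ifs <;> omega
  refine ⟨planeReflection μ h0 hL κ, ?_⟩
  simp only [planeReflection, Bond.tgt, shift, Function.update_self, Coord.coe_next, c]
  split_ifs <;> omega

/-! ### The Hamiltonian with field as a sum over bonds -/

/-- The field including the staggering sign, as a function of the bonds. -/
def bondField (h : Fin ν → Site ν L → ℝ) (b : Bond ν L) : ℝ := staggerSign b.1 * h b.2 b.1

lemma shift_injective (μ : Fin ν) : Function.Injective fun x : Site ν L => shift x μ := by
  intro x y hxy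
  funext j
  have hj := congrFun hxy j
  by_cases h : j = μ
  · subst h
    simp only [shift, Function.update_self] at hj
    have hv := congrArg (Subtype.val) hj
    have h1 := (x j).2.1
    have h2 := (y j).2.1
    rw [Coord.coe_next, Coord.coe_next] at hv
    apply Subtype.ext
    split_ifs at hv <;> omega
  · simpa [shift, h] using hj

lemma shift_ne (x : Site ν L) (μ : Fin ν) : x ≠ shift x μ := by
  intro hx
  have hv := congrArg (fun y : Site ν L => ((y μ : Coord L) : ℤ)) hx
  simp only [shift, Function.update_self, Coord.coe_next] at hv
  split_ifs at hv <;> omega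

/-- Sums over all sites are invariant under translations. -/
lemma sum_shift {A : Type*} [AddCommMonoid A] (f : Site ν L → A) (μ : Fin ν) :
    ∑ x, f (shift x μ) = ∑ x, f x :=
  Equiv.sum_comp (Equiv.ofBijective _ (Finite.injective_iff_bijective.1 (shift_injective μ))) f

/-- Translation invariance makes both end points contribute the same sum of squares in each of the
`ν` directions; the resulting `2ν` matches the on-site counterterms of `interaction`. -/
lemma sum_sq_add (a : ℕ) :
    ∑ x : Site ν L, ∑ μ : Fin ν, (spin a x + spin a (shift x μ)) ^ 2 =
      (2 * ν : ℂ) • ∑ x, spin a x ^ 2 +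
        (2 : ℂ) • ∑ x, ∑ μ, spin a x * spin a (shift x μ) := by
  have h : ∀ (x : Site ν L) (μ : Fin ν), (spin a x + spin a (shift x μ)) ^ 2 =
      spin a x ^ 2 + spin a (shift x μ) ^ 2 + (2 : ℂ) • (spin a x * spin a (shift x μ)) := by
    intro x μ
    rw [sq, sq, sq, add_mul, mul_add, mul_add, ← (spin_commute a a (shift_ne x μ)).eq]
    module
  simp only [h, Finset.sum_add_distrib, ← Finset.smul_sum]
  rw [Finset.sum_comm (f := fun x (μ : Fin ν) => spin a (shift x μ) ^ 2)]
  simp only [sum_shift fun x => spin a x ^ 2, Finset.sum_const, Finset.card_univ, Fintype.card_fin,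
    ← Nat.cast_smul_eq_nsmul ℂ, ← Finset.smul_sum]
  module

lemma sum_sq_sub (a : ℕ) :
    ∑ x : Site ν L, ∑ μ : Fin ν, (spin a x - spin a (shift x μ)) ^ 2 =
      (2 * ν : ℂ) • ∑ x, spin a x ^ 2 -
        (2 : ℂ) • ∑ x, ∑ μ, spin a x * spin a (shift x μ) := by
  have h : ∀ (x : Site ν L) (μ : Fin ν), (spin a x - spin a (shift x μ)) ^ 2 =
      spin a x ^ 2 + spin a (shift x μ) ^ 2 - (2 : ℂ) • (spin a x * spin a (shift x μ)) := by
    intro x μ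
    rw [sq, sq, sq, sub_mul, mul_sub, mul_sub, ← (spin_commute a a (shift_ne x μ)).eq]
    module
  simp only [h, Finset.sum_add_distrib, Finset.sum_sub_distrib, ← Finset.smul_sum]
  rw [Finset.sum_comm (f := fun x (μ : Fin ν) => spin a (shift x μ) ^ 2)]
  simp only [sum_shift fun x => spin a x ^ 2, Finset.sum_const, Finset.card_univ, Fintype.card_fin,
    ← Nat.cast_smul_eq_nsmul ℂ, ← Finset.smul_sum]
  module

lemma sum_sq_field (h : Fin ν → Site ν L → ℝ) :
    ∑ x : Site ν L, ∑ μ : Fin ν,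
      (spin 3 x + spin 3 (shift x μ) + (stagger x * (h μ x : ℂ)) • (1 : Op ν L)) ^ 2 =
    ∑ x : Site ν L, ∑ μ : Fin ν, (spin 3 x + spin 3 (shift x μ)) ^ 2 +
    (2 : ℂ) • ∑ b : Bond ν L, (((bondField h b : ℝ) : ℂ) • (spin 3 b.1 + spin 3 b.tgt) +
      ((bondField h b ^ 2 / 2 : ℝ) : ℂ) • (1 : Op ν L)) := by
  rw [Fintype.sum_prod_type, Finset.smul_sum, ← Finset.sum_add_distrib]
  refine Finset.sum_congr rfl fun x _ => ?_
  rw [Finset.smul_sum, ← Finset.sum_add_distrib]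
  refine Finset.sum_congr rfl fun μ _ => ?_
  have h1 : ∀ (u : Op ν L) (c : ℂ), (u + c • (1 : Op ν L)) ^ 2 =
      u ^ 2 + (2 : ℂ) • (c • u + (c ^ 2 / 2) • (1 : Op ν L)) := by
    intro u c
    rw [sq, sq, add_mul, mul_add, mul_add, smul_mul_smul_comm, mul_smul_comm, smul_mul_assoc,
      one_mul, mul_one, mul_one]
    module
  rw [h1, ← ofReal_staggerSign]
  simp only [bondField, Bond.tgt]
  push_cast
  rfl

lemma interaction_eq (g : ℝ) (h : Fin ν → Site ν L → ℝ) :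
    interaction g h =
      (g : ℂ) • ∑ a ∈ Finset.Icc 1 8, ∑ x : Site ν L, ∑ μ, spin a x * spin a (shift x μ) +
      (g : ℂ) • ∑ b : Bond ν L, (((bondField h b : ℝ) : ℂ) • (spin 3 b.1 + spin 3 b.tgt) +
        ((bondField h b ^ 2 / 2 : ℝ) : ℂ) • (1 : Op ν L)) := by
  have swap : ∀ (s : Finset ℕ) (f : ℕ → Site ν L → Fin ν → Op ν L),
      ∑ x, ∑ μ, ∑ b ∈ s, f b x μ = ∑ b ∈ s, ∑ x, ∑ μ, f b x μ := by
    intro s f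
    rw [Finset.sum_comm (s := s)]
    refine Finset.sum_congr rfl fun x _ => ?_
    rw [Finset.sum_comm]
  have hIcc : Finset.Icc 1 8 = ({1, 2, 3, 4, 5, 6, 7, 8} : Finset ℕ) := rfl
  rw [interaction, sum_sq_field, swap, swap, hIcc]
  simp only [sum_sq_add, sum_sq_sub]
  simp only [Finset.mem_insert, Finset.mem_singleton, Finset.sum_insert, Finset.sum_singleton,
    Nat.reduceEqDiff, or_self, not_false_eq_true, OfNat.one_ne_ofNat]
  push_cast
  module

lemma hamiltonianField_eq (κ g m : ℝ) (h : Fin ν → Site ν L → ℝ) :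
    hamiltonianField κ g m h = bondHamiltonian κ g m (bondField h) := by
  have hK : kinetic κ = ∑ b : Bond ν L, (Complex.I * (κ * b.hopSign : ℝ)) •
      (hop b.1 b.tgt - hop b.tgt b.1) := by
    rw [kinetic, Fintype.sum_prod_type, Finset.smul_sum]
    refine Finset.sum_congr rfl fun x _ => ?_
    rw [Finset.smul_sum]
    refine Finset.sum_congr rfl fun μ _ => ?_
    rw [smul_smul, Bond.hopSign, Bond.tgt]
    push_cast
    rw [mul_assoc]
  have hO : (m : ℂ) • (orderParameter : Op ν L) =
      ∑ x, ((m * staggerSign x : ℝ) : ℂ) • spin 2 x := by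
    rw [orderParameter, Finset.smul_sum]
    refine Finset.sum_congr rfl fun x _ => ?_
    rw [smul_smul, ← ofReal_staggerSign, Complex.ofReal_mul]
  have hS : ∑ a ∈ Finset.Icc 1 8, ∑ x : Site ν L, ∑ μ, spin a x * spin a (shift x μ) =
      ∑ b : Bond ν L, ∑ a ∈ Finset.Icc 1 8, spin a b.1 * spin a b.tgt := by
    rw [Finset.sum_comm (s := Finset.univ)]
    refine Finset.sum_congr rfl fun a _ => ?_
    rw [Fintype.sum_prod_type]
    rfl
  rw [hamiltonianField, bondHamiltonian, interaction_eq, hK, hO, hS, Finset.smul_sum,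
    Finset.smul_sum, ← Finset.sum_add_distrib, ← Finset.sum_add_distrib]
  congr 1
  refine Finset.sum_congr rfl fun b _ => ?_
  simp only [bondTerm, genSpin_psi, genHop_psi]
  push_cast
  module

lemma hamiltonianField_zero (κ g m : ℝ) :
    hamiltonianField κ g m (0 : Fin ν → Site ν L → ℝ) = hamiltonian κ g m := by
  have h0 : ∀ b : Bond ν L, bondField (0 : Fin ν → Site ν L → ℝ) b = 0 := by
    intro b; simp [bondField]
  rw [hamiltonianField, hamiltonian, interaction_eq]
  simp only [h0, Complex.ofReal_zero, zero_smul, zero_pow two_ne_zero, zero_div, add_zero,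
    Finset.sum_const_zero, smul_zero]
  rw [add_right_comm, Finset.sum_comm]
  congr 2
  refine Finset.sum_congr rfl fun x _ => ?_
  rw [Finset.sum_comm]

/-! ### Positivity of the partition function -/

lemma isHermitian_spin (a : ℕ) (x : Site ν L) : (spin a x)ᴴ = spin a x := by
  simp only [spin, Matrix.conjTranspose_sum, Matrix.conjTranspose_smul, Matrix.conjTranspose_mul,
    Matrix.conjTranspose_conjTranspose, star_gellMann]
  rw [Finset.sum_comm]

lemma conjTranspose_hop (x y : Site ν L) : (hop x y)ᴴ = hop y x := by
  simp [hop, Matrix.conjTranspose_sum, Matrix.conjTranspose_mul]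

lemma isHermitian_bondTerm (κ g w : ℝ) (b : Bond ν L) :
    (bondTerm psi psiDag κ g w b)ᴴ = bondTerm psi psiDag κ g w b := by
  have hc : ∀ a, spin a b.tgt * spin a b.1 = spin a b.1 * spin a b.tgt := fun a =>
    (spin_commute a a (shift_ne b.1 b.2)).eq.symm
  simp only [bondTerm, genSpin_psi, genHop_psi, Matrix.conjTranspose_add,
    Matrix.conjTranspose_smul, Matrix.conjTranspose_sub, conjTranspose_hop,
    Matrix.conjTranspose_sum, Matrix.conjTranspose_mul, isHermitian_spin, hc,
    Matrix.conjTranspose_one, star_mul, Complex.star_def, Complex.conj_I, Complex.conj_ofReal]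
  module

lemma isHermitian_bondHamiltonian (κ g m : ℝ) (w : Bond ν L → ℝ) :
    (bondHamiltonian κ g m w)ᴴ = bondHamiltonian κ g m w := by
  simp only [bondHamiltonian, Matrix.conjTranspose_add, Matrix.conjTranspose_sum,
    isHermitian_bondTerm, Matrix.conjTranspose_smul, isHermitian_spin, Complex.star_def,
    Complex.conj_ofReal]

lemma trace_exp_nonneg {n : Type*} [Fintype n] [DecidableEq n] {X : Matrix n n ℂ} (hX : Xᴴ = X) :
    0 ≤ (NormedSpace.exp X).trace := by
  have h1 : NormedSpace.exp X =
      (NormedSpace.exp ((2 : ℂ)⁻¹ • X))ᴴ * NormedSpace.exp ((2 : ℂ)⁻¹ • X) := by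
    rw [← Matrix.exp_conjTranspose, Matrix.conjTranspose_smul, hX]
    have : star (2 : ℂ)⁻¹ = 2⁻¹ := by simp
    rw [this, ← Matrix.exp_add_of_commute _ _ (Commute.refl _), ← add_smul]
    norm_num
  rw [h1]
  exact (Matrix.posSemidef_conjTranspose_mul_self _).trace_nonneg

/-! ### Gaussian domination -/

/-- The partition function as a real number. -/
def partitionFn (κ g m β : ℝ) (w : Bond ν L → ℝ) : ℝ :=
  ‖(NormedSpace.exp (-(β : ℂ) • bondHamiltonian κ g m w)).trace‖

lemma ofReal_partitionFn (κ g m β : ℝ) (w : Bond ν L → ℝ) :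
    ((partitionFn κ g m β w : ℝ) : ℂ) =
      (NormedSpace.exp (-(β : ℂ) • bondHamiltonian κ g m w)).trace := by
  have h : 0 ≤ (NormedSpace.exp (-(β : ℂ) • bondHamiltonian κ g m w)).trace := by
    apply trace_exp_nonneg
    rw [Matrix.conjTranspose_smul, isHermitian_bondHamiltonian, star_neg, Complex.star_def,
      Complex.conj_ofReal]
  exact (RCLike.norm_of_nonneg' h)

/-- The number of bonds with nonvanishing field. -/
def numNonzero (w : Bond ν L → ℝ) : ℕ := (Finset.univ.filter fun b => w b ≠ 0).card

/-! ### Counting bonds with nonvanishing field -/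

namespace LatticeReflection

variable {κ : ℝ} (R : LatticeReflection ν L κ)

/-- The reflection to the left half of the field on the right half. -/
def pullback (w : Bond ν L → ℝ) (b : Bond ν L) : ℝ :=
  if R.left b.1 ∧ R.left b.tgt then -w (R.bond b) else 0

/-- The pullback is zero on crossing bonds, so there `p - q` is just `w`. -/
lemma glue_pullback (w : Bond ν L → ℝ) : R.glue w (R.pullback w) = w := by
  funext b
  have := R.left_bond_iff b
  unfold glue pullback
  by_cases h1 : R.left b.1 <;> by_cases h2 : R.left b.tgt <;> simp_all [R.bond_bond]

lemma glue_self_mem {S : Set ℝ} (h0 : 0 ∈ S) (hS : ∀ s ∈ S, -s ∈ S) {w : Bond ν L → ℝ}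
    (hw : ∀ b, w b ∈ S) (b : Bond ν L) : R.glue w w b ∈ S := by
  unfold glue
  split_ifs
  · exact hw b
  · simpa using h0
  · simpa using h0
  · exact hS _ (hw _)

lemma pullback_mem {S : Set ℝ} (h0 : 0 ∈ S) (hS : ∀ s ∈ S, -s ∈ S) {w : Bond ν L → ℝ}
    (hw : ∀ b, w b ∈ S) (b : Bond ν L) : R.pullback w b ∈ S := by
  unfold pullback
  split_ifs
  · exact hS _ (hw _)
  · exact h0

/-- The number of bonds in the left half with nonvanishing field. -/
def numLeft (w : Bond ν L → ℝ) : ℕ :=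
  (Finset.univ.filter fun b : Bond ν L => (R.left b.1 ∧ R.left b.tgt) ∧ w b ≠ 0).card

lemma card_right (w : Bond ν L → ℝ) :
    (Finset.univ.filter fun b : Bond ν L =>
      (¬ R.left b.1 ∧ ¬ R.left b.tgt) ∧ w (R.bond b) ≠ 0).card = R.numLeft w := by
  refine Finset.card_bij (fun b _ => R.bond b) ?_ ?_ ?_
  · intro b hb
    simpa [R.left_bond_iff] using hb
  · intro b _ b' _ h
    exact R.bondPerm.injective h
  · intro b hb
    refine ⟨R.bond b, ?_, R.bond_bond b⟩
    have h := R.left_bond_iff (R.bond b)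
    rw [R.bond_bond] at h
    simpa [R.bond_bond, ← h] using hb

/-- Crossing bonds carry `w - w = 0`, and the right half is a signed copy of the left. -/
lemma numNonzero_glue_self (w : Bond ν L → ℝ) : numNonzero (R.glue w w) = 2 * R.numLeft w := by
  have h : (Finset.univ.filter fun b => R.glue w w b ≠ 0) =
      (Finset.univ.filter fun b : Bond ν L => (R.left b.1 ∧ R.left b.tgt) ∧ w b ≠ 0) ∪
      Finset.univ.filter fun b : Bond ν L =>
        (¬ R.left b.1 ∧ ¬ R.left b.tgt) ∧ w (R.bond b) ≠ 0 := by
    ext b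
    simp only [Finset.mem_filter, Finset.mem_univ, true_and, Finset.mem_union, glue]
    by_cases h1 : R.left b.1 <;> by_cases h2 : R.left b.tgt <;> simp [h1, h2]
  rw [numNonzero, h, Finset.card_union_of_disjoint, R.card_right, numLeft, two_mul]
  rw [Finset.disjoint_filter]
  tauto

/-- Strict because the crossing bond `b` is counted in neither half. -/
lemma numLeft_add_lt (w : Bond ν L → ℝ) {b : Bond ν L} (hb : w b ≠ 0)
    (hR : ¬ (R.left b.1 ↔ R.left b.tgt)) :
    R.numLeft w + R.numLeft (R.pullback w) < numNonzero w := by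
  have h1 : R.numLeft (R.pullback w) = (Finset.univ.filter fun b : Bond ν L =>
      (¬ R.left b.1 ∧ ¬ R.left b.tgt) ∧ w b ≠ 0).card := by
    rw [← R.card_right]
    congr 1
    ext b
    simp only [Finset.mem_filter, Finset.mem_univ, true_and]
    refine and_congr_right fun h => ?_
    rw [pullback, if_pos ((R.left_bond_iff b).2 h), R.bond_bond, neg_ne_zero]
  rw [h1, numLeft, ← Finset.card_union_of_disjoint, numNonzero]
  · apply Finset.card_lt_card
    rw [Finset.ssubset_iff_of_subset]
    · refine ⟨b, by simpa using hb, ?_⟩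
      simp only [Finset.mem_union, Finset.mem_filter, Finset.mem_univ, true_and]
      tauto
    · intro b
      simp only [Finset.mem_union, Finset.mem_filter, Finset.mem_univ, true_and]
      tauto
  · rw [Finset.disjoint_filter]
    tauto

end LatticeReflection

theorem partitionFn_le_zero {κ g β : ℝ} (hg : 0 ≤ g) (hβ : 0 ≤ β) (m : ℝ) (w : Bond ν L → ℝ) :
    partitionFn κ g m β w ≤ partitionFn κ g m β (0 : Bond ν L → ℝ) := by
  let Z := partitionFn (ν := ν) (L := L) κ g m β
  have hZ : ∀ w, 0 ≤ Z w := fun w => norm_nonneg _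
  -- Symmetrized fields take only the values `0` and `±` old values, so the search stays in a finite
  -- set and no compactness or decay of `Z` is needed.
  let S : Set ℝ := {0} ∪ (Set.range w ∪ Set.range fun b => -w b)
  have hSfin : S.Finite :=
    (Set.finite_singleton 0).union ((Set.finite_range w).union (Set.finite_range _))
  have h0 : (0 : ℝ) ∈ S := Or.inl rfl
  have hneg : ∀ s ∈ S, -s ∈ S := by
    rintro s (rfl | ⟨b, rfl⟩ | ⟨b, rfl⟩)
    · left; simp
    · right; right; exact ⟨b, rfl⟩
    · right; left; exact ⟨b, by simp⟩
  let 𝓢 : Set (Bond ν L → ℝ) := {v | ∀ b, v b ∈ S}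
  have h𝓢 : 𝓢.Finite := by
    have := Set.Finite.pi' (fun _ : Bond ν L => hSfin)
    exact this
  have hw : w ∈ 𝓢 := fun b => Or.inr (Or.inl ⟨b, rfl⟩)
  obtain ⟨v₀, hv₀, hmax₀⟩ := Set.exists_max_image 𝓢 Z h𝓢 ⟨w, hw⟩
  have h𝓜 : {v ∈ 𝓢 | Z v = Z v₀}.Finite := h𝓢.subset (Set.sep_subset _ _)
  obtain ⟨v, ⟨hv, hvZ⟩, hmin⟩ := Set.exists_min_image _ numNonzero h𝓜 ⟨v₀, hv₀, rfl⟩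
  have hmax : ∀ u ∈ 𝓢, Z u ≤ Z v := fun u hu => hvZ ▸ hmax₀ u hu
  by_cases hv0 : v = 0
  · exact hv0 ▸ hmax w hw
  obtain ⟨b, hb⟩ : ∃ b, v b ≠ 0 := by
    by_contra h
    push Not at h
    exact hv0 (funext h)
  -- Positivity of the maximum is used below to turn `Z v ^ 2 ≤ Z v₁ * Z v₂`, with both factors at
  -- most `Z v`, into equality of all three.
  rcases (hZ v).eq_or_lt with hzero | hpos
  · exact (hmax w hw).trans (hzero ▸ hZ 0)
  exfalso
  obtain ⟨R, hR⟩ := exists_reflection_crossing κ b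
  have hRP : Z v ^ 2 ≤ Z (R.glue v v) * Z (R.glue (R.pullback v) (R.pullback v)) := by
    have := R.norm_trace_exp_glue_sq_le hg hβ m v (R.pullback v)
    rwa [R.glue_pullback] at this
  have m1 : R.glue v v ∈ 𝓢 := R.glue_self_mem h0 hneg hv
  have m2 : R.glue (R.pullback v) (R.pullback v) ∈ 𝓢 :=
    R.glue_self_mem h0 hneg (R.pullback_mem h0 hneg hv)
  have l1 := hmax _ m1
  have l2 := hmax _ m2
  have e1 : Z (R.glue v v) = Z v := by
    refine le_antisymm l1 ?_
    by_contra! hlt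
    nlinarith [mul_le_mul_of_nonneg_left l2 (hZ (R.glue v v))]
  have e2 : Z (R.glue (R.pullback v) (R.pullback v)) = Z v := by
    refine le_antisymm l2 ?_
    by_contra! hlt
    nlinarith [mul_le_mul_of_nonneg_right l1 (hZ (R.glue (R.pullback v) (R.pullback v)))]
  have n1 := hmin _ ⟨m1, e1.trans hvZ⟩
  have n2 := hmin _ ⟨m2, e2.trans hvZ⟩
  -- Minimality bounds `numNonzero v` by twice the count in either half; adding the two bounds
  -- contradicts `numLeft_add_lt`.
  rw [R.numNonzero_glue_self] at n1 n2
  have := R.numLeft_add_lt v hb hR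
  omega

end NJL

theorem proposition5p1 (ν L : ℕ) (hν : 1 ≤ ν) (hL : 1 ≤ L) (κ m g β : ℝ)
    (hm : 0 ≤ m) (hg : 0 ≤ g) (hβ : 0 ≤ β) :
    (NJL.hamiltonianField κ g m (0 : Fin ν → NJL.Site ν L → ℝ) = NJL.hamiltonian κ g m) ∧
    ∀ h : Fin ν → NJL.Site ν L → ℝ,
      (NormedSpace.exp (-(β : ℂ) • NJL.hamiltonianField κ g m h)).trace ≤
        (NormedSpace.exp (-(β : ℂ) • (NJL.hamiltonian κ g m : NJL.Op ν L))).trace := by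
  refine ⟨NJL.hamiltonianField_zero κ g m, fun h => ?_⟩
  have h0 : NJL.bondField (0 : Fin ν → NJL.Site ν L → ℝ) = 0 := by
    funext b; simp [NJL.bondField]
  rw [← NJL.hamiltonianField_zero, NJL.hamiltonianField_eq, NJL.hamiltonianField_eq, h0,
    ← NJL.ofReal_partitionFn, ← NJL.ofReal_partitionFn, Complex.real_le_real]
  exact NJL.partitionFn_le_zero hg hβ m _

end
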